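/- Fix an integer $n\ge 0$, $\delta=\frac1{n+1}$, and initial values $L(0,T_j)>0$, $1\le j\le n$. For every $k\in\mathbb N$ let $(\Omega^{(k)},\mathcal F^{(k)},(\mathcal F^{(k)}_i)_{i\in\mathbb N},\mathbb P^{(k)}_{n+1})$ be a filtered probability space, $(X^{(k)}_i)_{i\in\mathbb N}$ an adapted real process whose increments $U^{(k)}_i=X^{(k)}_i-X^{(k)}_{i-1}$, $i\ge1$, are independent of $\mathcal F^{(k)}_{i-1}$ under $\mathbb P^{(k)}_{n+1}$, $p^{(k)}\ge 1$ an integer, $m^{(k)}=(n+1)p^{(k)}$, and $\lambda^{(k)}_{ij}>0$, $0\le i\le m^{(k)}$, $1\le j\le n$, real numbers with $$\mathbb E_{\mathbb P^{(k)}_{n+1}}\Big[\exp\Big(\sum_{i=1}^{m^{(k)}}\sum_{j=1}^n\lambda^{(k)}_{ij}U^{(k)}_i\Big)\Big]<\infty .$$ The discrete LIBOR market model driven by $X^{(k)}$ on the grid $t_0,\dots,t_{m^{(k)}}$ with tenor dates $T_j=t_{jp^{(k)}}$ is defined by backward recursion on $j=n,\dots,1$: given $\mathbb P^{(k)}_{j+1}$,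 put $$b^{j,(k)}_{i}=-\frac1{\lambda^{(k)}_{ij}}\log\mathbb E_{\mathbb P^{(k)}_{j+1}}\big[\exp(\lambda^{(k)}_{ij}U^{(k)}_i)\,\big|\,\mathcal F^{(k)}_{i-1}\big],\qquad L^{(k)}(t_i,T_j)=L(0,T_j)\exp\Big(\sum_{u=1}^i\lambda^{(k)}_{uj}\big(U^{(k)}_u+b^{j,(k)}_{u}\big)\Big),\quad 0\le i\le jp^{(k)},$$ and, for $j\ge2$, define the forward measure $\mathbb P^{(k)}_j$ on $\mathcal F^{(k)}$ by $$\frac{d\mathbb P^{(k)}_j}{d\mathbb P^{(k)}_{j+1}}=\frac{1+\delta L^{(k)}(T_j,T_j)}{1+\delta L(0,T_j)} .$$ For $1\le i\le m^{(k)}$ let $\nu^{(k)}_i$ be the law of $U^{(k)}_i+b^{n,(k)}_{i}$ under $\mathbb P^{(k)}_{n+1}$, where $b^{n,(k)}_i$ is given by the formula above for all $i\le m^{(k)}$; that is, $\sum_i\nu_i^{(k)}$ is the compensator over the whole time interval of the jump measure of the process $\sum_{u\le i}(U^{(k)}_u+b^{n,(k)}_u)$. Assume that there are real numbers $\varepsilon>0$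 and $M$ such that $\sum_{j=1}^n|\lambda^{(k)}_{ij}|\le M$ for all sufficiently large $k$ and all $1\le i\le m^{(k)}$, that $$\sup_{k}\sum_{i=1}^{m^{(k)}}\int_{|x|>1}e^{ux}\,\nu^{(k)}_i(dx)<\infty\quad\text{for every real }u\text{ with }|u|\le(1+\varepsilon)M,$$ and that $$\sup_{k}\sum_{i=1}^{m^{(k)}}\int_{\mathbb R}(x^2\wedge1)\,\nu^{(k)}_i(dx)<\infty .$$ Then for all $j,l\in\{2,\dots,n+1\}$ the sequence $(\mathbb P^{(k)}_j)_k$ is contiguous with respect to $(\mathbb P^{(k)}_l)_k$: whenever $A_k\in\mathcal F^{(k)}$ and $\mathbb P^{(k)}_l(A_k)\to0$, also $\mathbb P^{(k)}_j(A_k)\to0$. -/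

import Mathlib

open MeasureTheory ProbabilityTheory Filter Topology
open scoped ENNReal

noncomputable section

/-- Contiguity `Q ◁ P` of two sequences of measures on a sequence of measurable spaces:
`P k (A k) → 0` implies `Q k (A k) → 0`, for all measurable sets `A k`. -/
def Contiguous {Ω : ℕ → Type*} [∀ k, MeasurableSpace (Ω k)]
    (Q P : ∀ k, Measure (Ω k)) : Prop :=
  ∀ A : ∀ k, Set (Ω k), (∀ k, MeasurableSet (A k)) →
    Tendsto (fun k => P k (A k)) atTop (𝓝 0) → Tendsto (fun k => Q k (A k)) atTop (𝓝 0)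

/-- The data driving one discrete LIBOR market model with `n` rates: a stochastic basis in discrete
time with terminal measure `P`, an adapted process `X` with independent increments, the number `p`
of grid points per tenor period (so that the grid is `t_0, …, t_m` with `m = (n + 1) p` and the
`j`-th tenor date is `T_j = t_{j p}`), and the volatilities `lam i j = λ_{ij}`. -/
structure LiborData (n : ℕ) (Ω : Type*) [mΩ : MeasurableSpace Ω] where
  /-- the terminal measure `ℙ_{n+1}` -/
  P : Measure Ω
  isProbabilityMeasure : IsProbabilityMeasure P
  /-- the filtration, `ℱ i` being the information at time `t_i` -/
  ℱ : Filtration ℕ mΩ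
  /-- the driving process -/
  X : ℕ → Ω → ℝ
  adapted : ∀ i, Measurable[ℱ i] (X i)
  indep_increments : ∀ i, Indep (MeasurableSpace.comap (fun ω => X (i + 1) ω - X i ω) (borel ℝ))
    (ℱ i) P
  /-- the number of grid points per tenor period -/
  p : ℕ
  p_pos : 0 < p
  /-- the volatilities -/
  lam : ℕ → ℕ → ℝ
  lam_pos : ∀ i ≤ (n + 1) * p, ∀ j ∈ Finset.Icc 1 n, 0 < lam i j
  integrable_exp : Integrable (fun ω => Real.exp (∑ i ∈ Finset.Icc 1 ((n + 1) * p),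
    ∑ j ∈ Finset.Icc 1 n, lam i j * (X i ω - X (i - 1) ω))) P

namespace LiborData

variable {n : ℕ} {Ω : Type*} [MeasurableSpace Ω] (D : LiborData n Ω) (L₀ : ℕ → ℝ)

/-- The increment `U_i = X_i - X_{i-1}` of the driving process, for `i ≥ 1`. -/
def increment (i : ℕ) (ω : Ω) : ℝ := D.X i ω - D.X (i - 1) ω

/-- The drift `-(1 / λ_{ij}) log E_Q (exp (λ_{ij} U_i) | ℱ_{i-1})`, computed under a measure `Q`. -/
def driftUnder (Q : Measure Ω) (j i : ℕ) (ω : Ω) : ℝ :=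
  -(1 / D.lam i j) *
    Real.log ((Q[fun ω' => Real.exp (D.lam i j * D.increment i ω') | D.ℱ (i - 1)]) ω)

/-- The `j`-th rate at time `t_i`, `L₀ j * exp (∑_{u ≤ i} λ_{uj} (U_u + b_u))`, where the drift `b`
is computed under `Q`. -/
def rateUnder (Q : Measure Ω) (j i : ℕ) (ω : Ω) : ℝ :=
  L₀ j * Real.exp (∑ u ∈ Finset.Icc 1 i, D.lam u j * (D.increment u ω + D.driftUnder Q j u ω))

/-- The accrual period `δ = 1 / (n + 1)`. -/
def delta (_D : LiborData n Ω) : ℝ := 1 / ((n : ℝ) + 1)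

/-- Backward recursion for the forward measures: the `d`-th one is `ℙ_{n+1-d}`. It starts with the
terminal measure `ℙ_{n+1}`, and `ℙ_j` is obtained from `ℙ_{j+1}`, `j = n - d`, through the density
`(1 + δ L(T_j, T_j)) / (1 + δ L(0, T_j))`, where `L(·, T_j)` has the drift computed
under `ℙ_{j+1}`. -/
def forwardMeasureAux : ℕ → Measure Ω
  | 0 => D.P
  | d + 1 => (forwardMeasureAux d).withDensity fun ω => ENNReal.ofReal
      ((1 + D.delta * D.rateUnder L₀ (forwardMeasureAux d) (n - d) ((n - d) * D.p) ω) /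
        (1 + D.delta * L₀ (n - d)))

/-- The forward measure `ℙ_j`, `j ≤ n + 1`. -/
def forwardMeasure (j : ℕ) : Measure Ω := D.forwardMeasureAux L₀ (n + 1 - j)

/-- The rate `L(t_i, T_j)`, `1 ≤ j ≤ n`, `i ≤ j p`. -/
def rate (j i : ℕ) (ω : Ω) : ℝ := D.rateUnder L₀ (D.forwardMeasure L₀ (j + 1)) j i ω

theorem forwardMeasure_terminal : D.forwardMeasure L₀ (n + 1) = D.P := by
  simp [forwardMeasure, forwardMeasureAux]

theorem forwardMeasure_eq_withDensity {j : ℕ} (hj : j ≤ n) :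
    D.forwardMeasure L₀ j = (D.forwardMeasure L₀ (j + 1)).withDensity fun ω => ENNReal.ofReal
      ((1 + D.delta * D.rate L₀ j (j * D.p) ω) / (1 + D.delta * L₀ j)) := by
  have h1 : n + 1 - j = (n - j) + 1 := by omega
  have h2 : n + 1 - (j + 1) = n - j := by omega
  have h3 : n - (n - j) = j := by omega
  simp only [rate, forwardMeasure, h1, h2, forwardMeasureAux, h3]

/-- The part at time `t_i` of the compensator, under the terminal measure, of the jump measure of
the process `∑_{u ≤ i} (U_u + b_u)`, with the drift `b` of the last rate computed under the
terminal measure. Since `U_i` is independent of `ℱ_{i-1}` and `b_i` is `ℱ_{i-1}`-measurable and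
almost surely constant, the conditional law of the jump given `ℱ_{i-1}` is its law. -/
def compensator (i : ℕ) : Measure ℝ :=
  D.P.map fun ω => D.increment i ω + D.driftUnder D.P n i ω

end LiborData

end

/-! Everything is compared with the terminal measure `P`, which is `ℙ_{n+1}`. One direction is
cheap: rates are positive, so the density of `ℙ_l` with respect to `P` is bounded below by a
deterministic constant (`measure_le_forwardMeasure`). For the other direction, Hölder's inequality
bounds `ℙ_j A` by the `L^{1+ε}` norm of the density times a power of `P A`. It remains to bound the
moment of order `1 + ε` of the density uniformly in `k` (`lintegral_density_rpow_le`).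

The obstacle is the random drift of `L(·, T_r)`, computed under `ℙ_{r+1}`. By the martingale
property of the rates, the density process of `ℙ_{r+1}` is an explicit product (`isForwardDensity`);
given `ℱ_i`, its value at `t_{i+1}` is a nonnegative combination of exponentials `exp (s U_{i+1})`
with `s ≥ 0`. Chebyshev's association inequality then shows that changing from `P` to `ℙ_{r+1}` can
only raise the conditional exponential moments of `U_{i+1}` (`expMoment_le_condExp`). Hence the
drift is at most a deterministic one (`rate_le_rateBound`), and after this replacement the moment of
the density splits over the independent increments.

A single step is estimated through the law `ν_i` of `U_i + b_i^n`. Its exponential moment of order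
`λ_{in}` is `1`, so its mean is nonpositive and at least `-C σ_i`, where `σ_i` integrates `x² ∧ 1`
plus exponential tails of order `(1 + ε) M`. Taylor estimates and Jensen's inequality bound the step
by `exp (C' σ_i)` (`expMoment_mul_exp_logMoment_le`), and by assumption `∑ σ_i` is bounded in `k`.
-/

noncomputable section

/-! ### Conditional expectations through Lebesgue integrals of nonnegative functions. -/

section ConditionalExpectation

variable {Ω : Type*} {m m₀ : MeasurableSpace Ω}

theorem lintegral_eq_of_forall_measurableSet {μ ν : Measure Ω} (hm : m ≤ m₀)
    (h : ∀ A, MeasurableSet[m] A → μ A = ν A) {f : Ω → ℝ≥0∞} (hf : Measurable[m] f) :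
    ∫⁻ ω, f ω ∂μ = ∫⁻ ω, f ω ∂ν := by
  have htrim : μ.trim hm = ν.trim hm := by
    refine @Measure.ext _ m _ _ fun A hA => ?_
    rw [trim_measurableSet_eq hm hA, trim_measurableSet_eq hm hA, h A hA]
  rw [← lintegral_trim hm hf, htrim, lintegral_trim hm hf]

theorem setLIntegral_ofReal_condExp {μ : Measure Ω} [IsFiniteMeasure μ] (hm : m ≤ m₀)
    {f : Ω → ℝ} (hf : Integrable f μ) (hf₀ : 0 ≤ f) {A : Set Ω} (hA : MeasurableSet[m] A) :
    ∫⁻ ω in A, ENNReal.ofReal ((μ[f | m]) ω) ∂μ = ∫⁻ ω in A, ENNReal.ofReal (f ω) ∂μ := by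
  have h0 : 0 ≤ᵐ[μ] μ[f | m] := condExp_nonneg (Eventually.of_forall hf₀)
  rw [← ofReal_integral_eq_lintegral_ofReal integrable_condExp.integrableOn (ae_restrict_of_ae h0),
    setIntegral_condExp hm hf hA,
    ofReal_integral_eq_lintegral_ofReal hf.integrableOn (Eventually.of_forall hf₀)]

/-- The measures with densities `f` and `μ[f | m]` agree on `m`, hence integrate `g` equally.
Working in `ℝ≥0∞` avoids any integrability assumption on the product with `g`. -/
theorem lintegral_mul_ofReal_condExp {μ : Measure Ω} [IsFiniteMeasure μ] (hm : m ≤ m₀)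
    {f : Ω → ℝ} (hf : Integrable f μ) (hf_meas : Measurable f) (hf₀ : 0 ≤ f)
    {g : Ω → ℝ≥0∞} (hg : Measurable[m] g) :
    ∫⁻ ω, g ω * ENNReal.ofReal ((μ[f | m]) ω) ∂μ = ∫⁻ ω, g ω * ENNReal.ofReal (f ω) ∂μ := by
  have hc : Measurable fun ω => ENNReal.ofReal ((μ[f | m]) ω) :=
    (stronglyMeasurable_condExp.measurable.mono hm le_rfl).ennreal_ofReal
  have hg' : Measurable g := hg.mono hm le_rfl
  have key := lintegral_eq_of_forall_measurableSet
    (μ := μ.withDensity fun ω => ENNReal.ofReal ((μ[f | m]) ω))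
    (ν := μ.withDensity fun ω => ENNReal.ofReal (f ω)) hm (fun A hA => by
      rw [withDensity_apply _ (hm A hA), withDensity_apply _ (hm A hA),
        setLIntegral_ofReal_condExp hm hf hf₀ hA]) hg
  rw [lintegral_withDensity_eq_lintegral_mul _ hc hg',
    lintegral_withDensity_eq_lintegral_mul _ hf_meas.ennreal_ofReal hg'] at key
  simpa only [Pi.mul_apply, mul_comm] using key

theorem le_condExp_of_forall_le_setLIntegral {μ : Measure Ω} [IsFiniteMeasure μ] (hm : m ≤ m₀)
    {f : Ω → ℝ} (hf : Integrable f μ) (hf₀ : 0 ≤ f) {c : ℝ} (hc : 0 < c)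
    (h : ∀ A, MeasurableSet[m] A →
      ENNReal.ofReal c * μ A ≤ ∫⁻ ω in A, ENNReal.ofReal (f ω) ∂μ) :
    ∀ᵐ ω ∂μ, c ≤ (μ[f | m]) ω := by
  have hmeas : Measurable[m] fun ω => ENNReal.ofReal ((μ[f | m]) ω) :=
    stronglyMeasurable_condExp.measurable.ennreal_ofReal
  have key : (fun _ => ENNReal.ofReal c) ≤ᵐ[μ.trim hm] fun ω => ENNReal.ofReal ((μ[f | m]) ω) := by
    refine ae_le_of_forall_setLIntegral_le_of_sigmaFinite measurable_const fun A hA _ => ?_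
    rw [restrict_trim hm μ hA, lintegral_trim hm hmeas, setLIntegral_ofReal_condExp hm hf hf₀ hA,
      lintegral_trim hm measurable_const, lintegral_const, Measure.restrict_apply_univ]
    exact h A hA
  filter_upwards [ae_of_ae_trim hm key] with ω hω
  by_contra hlt
  exact absurd hω (not_le.2 ((ENNReal.ofReal_lt_ofReal_iff hc).2 (not_le.1 hlt)))

end ConditionalExpectation

/-- Chebyshev's association inequality for two exponentials of the same random variable. -/
theorem lintegral_exp_mul_lintegral_exp_le {Ω : Type*} [MeasurableSpace Ω] {μ : Measure Ω}
    [IsProbabilityMeasure μ] {X : Ω → ℝ} {a b : ℝ} (ha : 0 ≤ a) (hb : 0 ≤ b)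
    (hXa : Integrable (fun ω => Real.exp (a * X ω)) μ)
    (hXb : Integrable (fun ω => Real.exp (b * X ω)) μ)
    (hXab : Integrable (fun ω => Real.exp ((a + b) * X ω)) μ) :
    (∫⁻ ω, ENNReal.ofReal (Real.exp (a * X ω)) ∂μ) *
      (∫⁻ ω, ENNReal.ofReal (Real.exp (b * X ω)) ∂μ) ≤
      ∫⁻ ω, ENNReal.ofReal (Real.exp ((a + b) * X ω)) ∂μ := by
  rcases ha.eq_or_lt with rfl | ha
  · simp
  have hpos (c : ℝ) : 0 ≤ᵐ[μ] fun ω => Real.exp (c * X ω) :=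
    Eventually.of_forall fun ω => (Real.exp_pos _).le
  rw [← ofReal_integral_eq_lintegral_ofReal hXa (hpos a),
    ← ofReal_integral_eq_lintegral_ofReal hXb (hpos b),
    ← ofReal_integral_eq_lintegral_ofReal hXab (hpos (a + b)),
    ← ENNReal.ofReal_mul (integral_exp_pos hXa).le]
  refine ENNReal.ofReal_le_ofReal ?_
  have hEpos : 0 < ∫ ω, Real.exp (a * X ω) ∂μ := integral_exp_pos hXa
  set E := ∫ ω, Real.exp (a * X ω) ∂μ with hE
  -- The level `t` satisfies `exp (a t) = E`, so `exp (a X) - E` and `exp (b X) - exp (b t)` always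
  -- have the same sign. On integrating their product, the term with `exp (b t)` vanishes because
  -- `exp (a X) - E` has mean zero.
  set t := Real.log E / a with ht
  have hEt : Real.exp (a * t) = E := by
    rw [ht, mul_div_cancel₀ _ ha.ne', Real.exp_log hEpos]
  have hpt : ∀ ω, E * Real.exp (b * X ω) + Real.exp (b * t) * (Real.exp (a * X ω) - E) ≤
      Real.exp ((a + b) * X ω) := by
    intro ω
    have hmul : 0 ≤ (Real.exp (a * X ω) - Real.exp (a * t)) *
        (Real.exp (b * X ω) - Real.exp (b * t)) := by
      rcases le_total t (X ω) with h | h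
      · exact mul_nonneg (sub_nonneg.2 (Real.exp_le_exp.2 (by gcongr)))
          (sub_nonneg.2 (Real.exp_le_exp.2 (by gcongr)))
      · exact mul_nonneg_of_nonpos_of_nonpos (sub_nonpos.2 (Real.exp_le_exp.2 (by gcongr)))
          (sub_nonpos.2 (Real.exp_le_exp.2 (by gcongr)))
    rw [add_mul, Real.exp_add, ← hEt]
    nlinarith
  have hint : Integrable (fun ω => Real.exp (b * t) * (Real.exp (a * X ω) - E)) μ :=
    (hXa.sub (integrable_const E)).const_mul _
  have hmono := integral_mono ((hXb.const_mul E).add hint) hXab hpt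
  have hz : ∫ ω, Real.exp (b * t) * (Real.exp (a * X ω) - E) ∂μ = 0 := by
    rw [integral_const_mul, integral_sub hXa (integrable_const E)]
    simp [← hE]
  simp only [Pi.add_apply] at hmono
  rw [integral_add (hXb.const_mul E) hint, hz, integral_const_mul, add_zero] at hmono
  exact hmono

/-! ### Measurability, and exponential moments of the increments under the terminal measure. -/

namespace LiborData

variable {n : ℕ} {Ω : Type*} [MeasurableSpace Ω] (D : LiborData n Ω) (L₀ : ℕ → ℝ)

instance : IsProbabilityMeasure D.P := D.isProbabilityMeasure

theorem measurable_increment (i : ℕ) : Measurable[D.ℱ i] (D.increment i) :=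
  (D.adapted i).sub ((D.adapted (i - 1)).mono (D.ℱ.mono (Nat.sub_le _ _)) le_rfl)

theorem measurable_increment' (i : ℕ) : Measurable (D.increment i) :=
  (D.measurable_increment i).mono (D.ℱ.le i) le_rfl

theorem measurable_driftUnder (Q : Measure Ω) (j i : ℕ) :
    Measurable[D.ℱ (i - 1)] (D.driftUnder Q j i) :=
  (Real.measurable_log.comp stronglyMeasurable_condExp.measurable).const_mul _

theorem measurable_rateUnder (Q : Measure Ω) (j i : ℕ) :
    Measurable[D.ℱ i] (D.rateUnder L₀ Q j i) := by
  refine (Real.measurable_exp.comp ?_).const_mul _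
  refine Finset.measurable_fun_sum _ fun u hu => ?_
  have hui : u ≤ i := (Finset.mem_Icc.1 hu).2
  exact (((D.measurable_increment u).mono (D.ℱ.mono hui) le_rfl).add
    ((D.measurable_driftUnder Q j u).mono (D.ℱ.mono ((Nat.sub_le _ _).trans hui))
      le_rfl)).const_mul _

theorem measurable_rate (j i : ℕ) : Measurable[D.ℱ i] (D.rate L₀ j i) :=
  D.measurable_rateUnder L₀ _ j i

theorem rate_zero (j : ℕ) (ω : Ω) : D.rate L₀ j 0 ω = L₀ j := by
  simp [rate, rateUnder]

theorem rate_succ (j i : ℕ) (ω : Ω) :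
    D.rate L₀ j (i + 1) ω = D.rate L₀ j i ω *
      Real.exp (D.lam (i + 1) j * D.driftUnder (D.forwardMeasure L₀ (j + 1)) j (i + 1) ω) *
      Real.exp (D.lam (i + 1) j * D.increment (i + 1) ω) := by
  simp only [rate, rateUnder]
  rw [Finset.sum_Icc_succ_top (by omega), Real.exp_add, mul_add, Real.exp_add]
  ring

theorem delta_pos : 0 < D.delta := by
  unfold delta; positivity

theorem delta_le_one : D.delta ≤ 1 := by
  unfold delta
  rw [div_le_one (by positivity)]
  linarith [(Nat.cast_nonneg n : (0 : ℝ) ≤ n)]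

/-- The exponential moment `E exp (c U_i)` under the terminal measure. -/
def expMoment (c : ℝ) (i : ℕ) : ℝ≥0∞ :=
  ∫⁻ ω, ENNReal.ofReal (Real.exp (c * D.increment i ω)) ∂D.P

theorem measurable_exp_mul_increment (c : ℝ) (i : ℕ) :
    Measurable[D.ℱ i] fun ω => Real.exp (c * D.increment i ω) :=
  Real.measurable_exp.comp ((D.measurable_increment i).const_mul c)

theorem measurable_exp_mul_increment' (c : ℝ) (i : ℕ) :
    Measurable fun ω => Real.exp (c * D.increment i ω) :=
  (D.measurable_exp_mul_increment c i).mono (D.ℱ.le i) le_rfl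

theorem expMoment_ne_zero (c : ℝ) (i : ℕ) : D.expMoment c i ≠ 0 := by
  rw [expMoment, ← pos_iff_ne_zero, lintegral_pos_iff_support
    (D.measurable_exp_mul_increment' c i).ennreal_ofReal]
  have : (Function.support fun ω => ENNReal.ofReal (Real.exp (c * D.increment i ω))) =
      Set.univ := by
    ext ω
    simp [Real.exp_pos]
  simp [this]

theorem lintegral_mul_exp_increment (c : ℝ) (i : ℕ) {C : Ω → ℝ≥0∞} (hC : Measurable[D.ℱ i] C) :
    ∫⁻ ω, C ω * ENNReal.ofReal (Real.exp (c * D.increment (i + 1) ω)) ∂D.P =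
      (∫⁻ ω, C ω ∂D.P) * D.expMoment c (i + 1) := by
  have hU : Measurable fun ω => D.X (i + 1) ω - D.X i ω := D.measurable_increment' (i + 1)
  refine lintegral_mul_eq_lintegral_mul_lintegral_of_independent_measurableSpace (D.ℱ.le i)
    hU.comap_le (D.indep_increments i).symm hC ?_
  refine Measurable.ennreal_ofReal (Real.measurable_exp.comp (Measurable.const_mul ?_ c))
  exact comap_measurable _

theorem lintegral_prod_exp_increment (c : ℕ → ℝ) (k : ℕ) :
    ∫⁻ ω, ∏ u ∈ Finset.Icc 1 k, ENNReal.ofReal (Real.exp (c u * D.increment u ω)) ∂D.P =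
      ∏ u ∈ Finset.Icc 1 k, D.expMoment (c u) u := by
  induction k with
  | zero => simp
  | succ k ih =>
    simp only [Finset.prod_Icc_succ_top (Nat.le_add_left 1 k)]
    rw [D.lintegral_mul_exp_increment, ih]
    refine Finset.measurable_fun_prod _ fun u hu => ?_
    exact ((D.measurable_exp_mul_increment (c u) u).mono (D.ℱ.mono (Finset.mem_Icc.1 hu).2)
      le_rfl).ennreal_ofReal

/-- The total volatility at time `t_i`. -/
def totalLam (i : ℕ) : ℝ := ∑ j ∈ Finset.Icc 1 n, D.lam i j

/-- By independence the integrability assumption is the finiteness of a product of one-step moments.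
No factor is zero, so none can be infinite. -/
theorem expMoment_totalLam_ne_top {i : ℕ} (hi : i ∈ Finset.Icc 1 ((n + 1) * D.p)) :
    D.expMoment (D.totalLam i) i ≠ ∞ := by
  intro htop
  have hfin := D.integrable_exp.lintegral_lt_top
  have heq : ∀ ω, ENNReal.ofReal (Real.exp (∑ i ∈ Finset.Icc 1 ((n + 1) * D.p),
      ∑ j ∈ Finset.Icc 1 n, D.lam i j * (D.X i ω - D.X (i - 1) ω))) =
      ∏ u ∈ Finset.Icc 1 ((n + 1) * D.p),
        ENNReal.ofReal (Real.exp (D.totalLam u * D.increment u ω)) := by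
    intro ω
    rw [Real.exp_sum, ENNReal.ofReal_prod_of_nonneg fun _ _ => (Real.exp_pos _).le]
    refine Finset.prod_congr rfl fun u _ => ?_
    rw [totalLam, Finset.sum_mul]
    rfl
  simp only [heq] at hfin
  rw [D.lintegral_prod_exp_increment, ← Finset.mul_prod_erase _ _ hi, htop, ENNReal.top_mul] at hfin
  · exact lt_irrefl _ hfin
  · exact Finset.prod_ne_zero_iff.2 fun u _ => D.expMoment_ne_zero _ _

/-- Orders between `0` and the total volatility are dominated pointwise by the sum of the
exponentials at the two endpoints. -/
theorem expMoment_ne_top {i : ℕ} (hi : i ∈ Finset.Icc 1 ((n + 1) * D.p)) {c : ℝ} (hc₀ : 0 ≤ c)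
    (hc : c ≤ D.totalLam i) : D.expMoment c i ≠ ∞ := by
  have hle : D.expMoment c i ≤ 1 + D.expMoment (D.totalLam i) i := by
    unfold expMoment
    rw [← lintegral_one.trans (measure_univ (μ := D.P)), ← lintegral_add_left measurable_const]
    refine lintegral_mono fun ω => ?_
    rw [← ENNReal.ofReal_one, ← ENNReal.ofReal_add zero_le_one (Real.exp_pos _).le]
    refine ENNReal.ofReal_le_ofReal ?_
    rcases le_total 0 (D.increment i ω) with h | h
    · have := Real.exp_le_exp.2 (mul_le_mul_of_nonneg_right hc h)
      linarith
    · have := Real.exp_le_one_iff.2 (mul_nonpos_of_nonneg_of_nonpos hc₀ h)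
      linarith [Real.exp_pos (D.totalLam i * D.increment i ω)]
  exact ne_top_of_le_ne_top (by simp [D.expMoment_totalLam_ne_top hi]) hle

theorem integrable_exp_mul_increment {i : ℕ} {c : ℝ} (h : D.expMoment c i ≠ ∞) :
    Integrable (fun ω => Real.exp (c * D.increment i ω)) D.P := by
  refine ⟨(D.measurable_exp_mul_increment' c i).aestronglyMeasurable, ?_⟩
  rw [hasFiniteIntegral_iff_ofReal (Eventually.of_forall fun _ => (Real.exp_pos _).le)]
  exact lt_top_iff_ne_top.2 h

theorem expMoment_mul_le {i : ℕ} (hi : i ∈ Finset.Icc 1 ((n + 1) * D.p)) {a b : ℝ} (ha : 0 ≤ a)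
    (hb : 0 ≤ b) (hab : a + b ≤ D.totalLam i) :
    D.expMoment a i * D.expMoment b i ≤ D.expMoment (a + b) i :=
  lintegral_exp_mul_lintegral_exp_le ha hb
    (D.integrable_exp_mul_increment (D.expMoment_ne_top hi ha (by linarith)))
    (D.integrable_exp_mul_increment (D.expMoment_ne_top hi hb (by linarith)))
    (D.integrable_exp_mul_increment (D.expMoment_ne_top hi (by linarith) hab))

end LiborData

/-! ### The density processes of the forward measures. -/

namespace LiborData

variable {n : ℕ} {Ω : Type*} [MeasurableSpace Ω] (D : LiborData n Ω) (L₀ : ℕ → ℝ)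

/-- The factor of the density of `ℙ_j` with respect to `ℙ_{j+1}`, at time `t_i`. -/
def densityFactor (j i : ℕ) (ω : Ω) : ℝ :=
  (1 + D.delta * D.rate L₀ j i ω) / (1 + D.delta * L₀ j)

/-- The density process of `ℙ_l` with respect to the terminal measure, for times up to `T_l`. -/
def densityAt (l i : ℕ) (ω : Ω) : ℝ :=
  ∏ r ∈ Finset.Icc l n, D.densityFactor L₀ r i ω

theorem measurable_densityFactor (j i : ℕ) : Measurable[D.ℱ i] (D.densityFactor L₀ j i) :=
  (((D.measurable_rate L₀ j i).const_mul _).const_add _).div_const _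

theorem measurable_densityFactor' (j i : ℕ) : Measurable (D.densityFactor L₀ j i) :=
  (D.measurable_densityFactor L₀ j i).mono (D.ℱ.le i) le_rfl

theorem measurable_densityAt (l i : ℕ) : Measurable[D.ℱ i] (D.densityAt L₀ l i) :=
  Finset.measurable_fun_prod _ fun r _ => D.measurable_densityFactor L₀ r i

theorem measurable_densityAt' (l i : ℕ) : Measurable (D.densityAt L₀ l i) :=
  (D.measurable_densityAt L₀ l i).mono (D.ℱ.le i) le_rfl

theorem forwardMeasure_eq_withDensity_densityFactor {j : ℕ} (hj : j ≤ n) :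
    D.forwardMeasure L₀ j = (D.forwardMeasure L₀ (j + 1)).withDensity fun ω =>
      ENNReal.ofReal (D.densityFactor L₀ j (j * D.p) ω) :=
  D.forwardMeasure_eq_withDensity L₀ hj

variable {L₀} (hL₀ : ∀ j ∈ Finset.Icc 1 n, 0 < L₀ j)
include hL₀

theorem rate_pos {j : ℕ} (hj : j ∈ Finset.Icc 1 n) (i : ℕ) (ω : Ω) : 0 < D.rate L₀ j i ω :=
  mul_pos (hL₀ j hj) (Real.exp_pos _)

theorem one_add_delta_mul_pos {j : ℕ} (hj : j ∈ Finset.Icc 1 n) : 0 < 1 + D.delta * L₀ j :=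
  add_pos one_pos (mul_pos D.delta_pos (hL₀ j hj))

theorem densityFactor_pos {j : ℕ} (hj : j ∈ Finset.Icc 1 n) (i : ℕ) (ω : Ω) :
    0 < D.densityFactor L₀ j i ω :=
  div_pos (add_pos one_pos (mul_pos D.delta_pos (D.rate_pos hL₀ hj i ω)))
    (D.one_add_delta_mul_pos hL₀ hj)

theorem densityFactor_zero {j : ℕ} (hj : j ∈ Finset.Icc 1 n) (ω : Ω) :
    D.densityFactor L₀ j 0 ω = 1 := by
  rw [densityFactor, rate_zero, div_self (D.one_add_delta_mul_pos hL₀ hj).ne']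

/-- Since rates are positive and `δ ≤ 1`, each density factor is at least `1 / (1 + L₀ r)`. No
moment assumption enters in this direction. -/
theorem measure_le_forwardMeasure {l : ℕ} (hl : 1 ≤ l) (hln : l ≤ n + 1) (A : Set Ω)
    (hA : MeasurableSet A) :
    D.P A ≤ (∏ r ∈ Finset.Icc l n, ENNReal.ofReal (1 + L₀ r)) * D.forwardMeasure L₀ l A := by
  induction hln using Nat.decreasingInduction with
  | self => simp [forwardMeasure_terminal]
  | of_succ l hln ih =>
    have hmem : l ∈ Finset.Icc 1 n := Finset.mem_Icc.2 ⟨hl, by omega⟩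
    refine (ih (by omega)).trans ?_
    rw [← Finset.insert_Icc_add_one_left_eq_Icc (show l ≤ n by omega),
      Finset.prod_insert (by simp), mul_comm (ENNReal.ofReal _), mul_assoc]
    gcongr
    rw [D.forwardMeasure_eq_withDensity_densityFactor L₀ (show l ≤ n by omega),
      withDensity_apply _ hA, ← lintegral_const_mul _
        (D.measurable_densityFactor' L₀ l _).ennreal_ofReal]
    rw [← setLIntegral_one]
    refine lintegral_mono fun ω => ?_
    have h0 := hL₀ l hmem
    rw [← ENNReal.ofReal_mul (by linarith), ← ENNReal.ofReal_one]
    refine ENNReal.ofReal_le_ofReal ?_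
    rw [densityFactor, ← mul_div_assoc, le_div_iff₀ (D.one_add_delta_mul_pos hL₀ hmem), one_mul]
    have h1 := mul_pos D.delta_pos (D.rate_pos hL₀ hmem (l * D.p) ω)
    have h2 := mul_le_of_le_one_left h0.le D.delta_le_one
    nlinarith

/-- At time `t_{i+1}`, the density process is a linear combination of exponentials of `U_{i+1}`
with nonnegative coefficients known at time `t_i`. -/
theorem exists_densityAt_succ_eq {l : ℕ} (hl : 1 ≤ l) (i : ℕ) :
    ∃ C : Finset ℕ → Ω → ℝ, (∀ S, Measurable[D.ℱ i] (C S)) ∧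
      (∀ S ∈ (Finset.Icc l n).powerset, 0 ≤ C S) ∧
      ∀ ω, D.densityAt L₀ l (i + 1) ω = ∑ S ∈ (Finset.Icc l n).powerset,
        C S ω * Real.exp ((∑ r ∈ S, D.lam (i + 1) r) * D.increment (i + 1) ω) := by
  -- Each density factor is affine in `exp (λ_r U_{i+1})`, with slope `d r` known at time `t_i`.
  -- Expanding the product over `r` gives one term for each set `S` of rates contributing their
  -- exponential.
  let d : ℕ → Ω → ℝ := fun r ω => D.delta * (D.rate L₀ r i ω *
      Real.exp (D.lam (i + 1) r * D.driftUnder (D.forwardMeasure L₀ (r + 1)) r (i + 1) ω)) /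
      (1 + D.delta * L₀ r)
  have hmem : ∀ r ∈ Finset.Icc l n, r ∈ Finset.Icc 1 n := fun r hr =>
    Finset.Icc_subset_Icc_left hl hr
  refine ⟨fun S ω => (∏ r ∈ S, d r ω) * ∏ r ∈ Finset.Icc l n \ S, 1 / (1 + D.delta * L₀ r),
    fun S => ?_, fun S hS ω => ?_, fun ω => ?_⟩
  · refine Measurable.mul_const (Finset.measurable_fun_prod _ fun r _ => ?_) _
    refine Measurable.div_const (Measurable.const_mul ((D.measurable_rate L₀ r i).mul ?_) _) _
    exact Real.measurable_exp.comp ((D.measurable_driftUnder _ r (i + 1)).const_mul _)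
  · refine mul_nonneg (Finset.prod_nonneg fun r hr => ?_) (Finset.prod_nonneg fun r hr => ?_)
    · have hr' := hmem r (Finset.mem_powerset.1 hS hr)
      exact div_nonneg (mul_nonneg D.delta_pos.le (mul_nonneg (D.rate_pos hL₀ hr' i ω).le
        (Real.exp_pos _).le)) (D.one_add_delta_mul_pos hL₀ hr').le
    · exact div_nonneg zero_le_one
        (D.one_add_delta_mul_pos hL₀ (hmem r (Finset.mem_sdiff.1 hr).1)).le
  · have hfac : ∀ r, D.densityFactor L₀ r (i + 1) ω =
        d r ω * Real.exp (D.lam (i + 1) r * D.increment (i + 1) ω) +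
          1 / (1 + D.delta * L₀ r) := by
      intro r
      simp only [densityFactor, rate_succ, d]
      ring
    simp only [densityAt, hfac, Finset.prod_add]
    refine Finset.sum_congr rfl fun S _ => ?_
    rw [Finset.prod_mul_distrib, Finset.sum_mul, Real.exp_sum]
    ring

omit hL₀ in
variable (L₀) in
/-- Up to time `T_l`, `densityAt l` is the density process of the forward measure `ℙ_l`. -/
def IsForwardDensity (l : ℕ) : Prop :=
  ∀ i ≤ l * D.p, ∀ A, MeasurableSet[D.ℱ i] A →
    D.forwardMeasure L₀ l A = ∫⁻ ω in A, ENNReal.ofReal (D.densityAt L₀ l i ω) ∂D.P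

omit hL₀ in
theorem lintegral_forwardMeasure {l i : ℕ} (h : D.IsForwardDensity L₀ l) (hi : i ≤ l * D.p)
    {f : Ω → ℝ≥0∞} (hf : Measurable[D.ℱ i] f) :
    ∫⁻ ω, f ω ∂(D.forwardMeasure L₀ l) =
      ∫⁻ ω, ENNReal.ofReal (D.densityAt L₀ l i ω) * f ω ∂D.P := by
  rw [lintegral_eq_of_forall_measurableSet (ν := D.P.withDensity fun ω =>
    ENNReal.ofReal (D.densityAt L₀ l i ω)) (D.ℱ.le i) (fun A hA => by
      rw [withDensity_apply _ (D.ℱ.le i A hA), h i hi A hA]) hf]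
  exact lintegral_withDensity_eq_lintegral_mul _
    (D.measurable_densityAt' L₀ l i).ennreal_ofReal (hf.mono (D.ℱ.le i) le_rfl)

theorem forwardMeasure_univ {l : ℕ} (hl : 1 ≤ l) (h : D.IsForwardDensity L₀ l) :
    D.forwardMeasure L₀ l Set.univ = 1 := by
  rw [h 0 (Nat.zero_le _) _ MeasurableSet.univ]
  have : ∀ ω, D.densityAt L₀ l 0 ω = 1 := fun ω => Finset.prod_eq_one fun r hr =>
    D.densityFactor_zero hL₀ (Finset.Icc_subset_Icc_left hl hr) ω
  simp [this]

/-- The point is that the weights do not depend on `a`: comparing a given order with `a = 0`, which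
yields the mass of `A`, becomes a comparison of terminal moments term by term. -/
theorem exists_setLIntegral_exp_forwardMeasure_eq {l i : ℕ} (hl : 1 ≤ l)
    (h : D.IsForwardDensity L₀ l) (hi : i + 1 ≤ l * D.p) {A : Set Ω} (hA : MeasurableSet[D.ℱ i] A) :
    ∃ w : Finset ℕ → ℝ≥0∞, ∀ a : ℝ,
      ∫⁻ ω in A, ENNReal.ofReal (Real.exp (a * D.increment (i + 1) ω)) ∂(D.forwardMeasure L₀ l) =
        ∑ S ∈ (Finset.Icc l n).powerset,
          w S * D.expMoment (∑ r ∈ S, D.lam (i + 1) r + a) (i + 1) := by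
  obtain ⟨C, hCm, hC₀, hC⟩ := D.exists_densityAt_succ_eq hL₀ hl i
  have hA' : MeasurableSet[D.ℱ (i + 1)] A := D.ℱ.mono (Nat.le_succ i) A hA
  have hind : ∀ S, Measurable[D.ℱ i] (A.indicator fun ω => ENNReal.ofReal (C S ω)) := fun S =>
    (hCm S).ennreal_ofReal.indicator hA
  refine ⟨fun S => ∫⁻ ω, A.indicator (fun ω => ENNReal.ofReal (C S ω)) ω ∂D.P, fun a => ?_⟩
  rw [← lintegral_indicator (D.ℱ.le _ _ hA'), D.lintegral_forwardMeasure h hi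
    ((D.measurable_exp_mul_increment a (i + 1)).ennreal_ofReal.indicator hA')]
  simp only [← D.lintegral_mul_exp_increment _ i (hind _)]
  have hmeas (S : Finset ℕ) : Measurable fun ω => A.indicator (fun ω => ENNReal.ofReal (C S ω)) ω *
      ENNReal.ofReal (Real.exp ((∑ r ∈ S, D.lam (i + 1) r + a) * D.increment (i + 1) ω)) :=
    ((hind S).mono (D.ℱ.le i) le_rfl).mul
      (D.measurable_exp_mul_increment' _ (i + 1)).ennreal_ofReal
  rw [← lintegral_finsetSum _ fun S _ => hmeas S]
  refine lintegral_congr fun ω => ?_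
  by_cases hω : ω ∈ A
  · simp only [Set.indicator_of_mem hω]
    rw [hC, ENNReal.ofReal_sum_of_nonneg fun S hS => mul_nonneg (hC₀ S hS ω) (Real.exp_pos _).le,
      Finset.sum_mul]
    refine Finset.sum_congr rfl fun S hS => ?_
    rw [← ENNReal.ofReal_mul (mul_nonneg (hC₀ S hS ω) (Real.exp_pos _).le),
      ← ENNReal.ofReal_mul (hC₀ S hS ω), mul_assoc, ← Real.exp_add, add_mul]
  · simp [Set.indicator_of_notMem hω]

end LiborData

/-! ### Comparison of conditional moments, and the martingale property of the rates. -/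

namespace LiborData

variable {n : ℕ} {Ω : Type*} [MeasurableSpace Ω] (D : LiborData n Ω) {L₀ : ℕ → ℝ}

theorem lam_pos_of_mem {i j : ℕ} (hi : i ∈ Finset.Icc 1 ((n + 1) * D.p)) (hj : j ∈ Finset.Icc 1 n) :
    0 < D.lam i j :=
  D.lam_pos i (Finset.mem_Icc.1 hi).2 j hj

theorem sum_lam_le_totalLam {i : ℕ} (hi : i ∈ Finset.Icc 1 ((n + 1) * D.p)) {S : Finset ℕ}
    (hS : S ⊆ Finset.Icc 1 n) : ∑ j ∈ S, D.lam i j ≤ D.totalLam i :=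
  Finset.sum_le_sum_of_subset_of_nonneg hS fun _ hj _ => (D.lam_pos_of_mem hi hj).le

theorem sum_lam_nonneg {i : ℕ} (hi : i ∈ Finset.Icc 1 ((n + 1) * D.p)) {S : Finset ℕ}
    (hS : S ⊆ Finset.Icc 1 n) : 0 ≤ ∑ j ∈ S, D.lam i j :=
  Finset.sum_nonneg fun _ hj => (D.lam_pos_of_mem hi (hS hj)).le

theorem expMoment_lam_ne_top {i j : ℕ} (hi : i ∈ Finset.Icc 1 ((n + 1) * D.p))
    (hj : j ∈ Finset.Icc 1 n) : D.expMoment (D.lam i j) i ≠ ∞ :=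
  D.expMoment_ne_top hi (D.lam_pos_of_mem hi hj).le (by
    simpa using D.sum_lam_le_totalLam hi (Finset.singleton_subset_iff.2 hj))

theorem mem_grid {l i : ℕ} (hln : l ≤ n + 1) (hi : i + 1 ≤ l * D.p) :
    i + 1 ∈ Finset.Icc 1 ((n + 1) * D.p) :=
  Finset.mem_Icc.2 ⟨by omega, hi.trans (Nat.mul_le_mul_right _ hln)⟩

variable (hL₀ : ∀ j ∈ Finset.Icc 1 n, 0 < L₀ j)
include hL₀

/-- Both sides are sums over `S` with the same weights, and the association inequality compares them
termwise. This set-integral form yields the lower bound on the conditional moment. -/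
theorem expMoment_mul_forwardMeasure_le {l i : ℕ} (hl : l ∈ Finset.Icc 1 n)
    (h : D.IsForwardDensity L₀ (l + 1)) (hi : i + 1 ≤ l * D.p) {A : Set Ω}
    (hA : MeasurableSet[D.ℱ i] A) :
    D.expMoment (D.lam (i + 1) l) (i + 1) * D.forwardMeasure L₀ (l + 1) A ≤
      ∫⁻ ω in A, ENNReal.ofReal (Real.exp (D.lam (i + 1) l * D.increment (i + 1) ω))
        ∂(D.forwardMeasure L₀ (l + 1)) := by
  have hl' := Finset.mem_Icc.1 hl
  have hgrid := D.mem_grid (show l ≤ n + 1 by omega) hi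
  obtain ⟨w, hw⟩ := D.exists_setLIntegral_exp_forwardMeasure_eq hL₀ (by omega) h
    (hi.trans (Nat.mul_le_mul_right _ (Nat.le_succ l))) hA
  have h0 := hw 0
  simp only [zero_mul, Real.exp_zero, ENNReal.ofReal_one, setLIntegral_one, add_zero] at h0
  rw [hw, h0, Finset.mul_sum]
  refine Finset.sum_le_sum fun S hS => ?_
  have hS' := Finset.mem_powerset.1 hS
  have hS1 : S ⊆ Finset.Icc 1 n := hS'.trans (Finset.Icc_subset_Icc_left (by omega))
  -- Only rates with index above `l` enter the density of `ℙ_{l+1}`. Hence adding `λ_l` to the order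
  -- given by `S` stays within the total volatility, where moments are finite.
  have hlS : l ∉ S := fun hlS => by
    have := (Finset.mem_Icc.1 (hS' hlS)).1
    omega
  have key := D.expMoment_mul_le hgrid (D.sum_lam_nonneg hgrid hS1) (D.lam_pos_of_mem hgrid hl).le
    (by
      have := D.sum_lam_le_totalLam hgrid (Finset.insert_subset hl hS1)
      rw [Finset.sum_insert hlS] at this
      linarith)
  calc D.expMoment (D.lam (i + 1) l) (i + 1) *
        (w S * D.expMoment (∑ r ∈ S, D.lam (i + 1) r) (i + 1))
      = w S * (D.expMoment (∑ r ∈ S, D.lam (i + 1) r) (i + 1) *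
        D.expMoment (D.lam (i + 1) l) (i + 1)) := by ring
    _ ≤ _ := by gcongr

theorem integrable_exp_forwardMeasure {l i : ℕ} (hl : l ∈ Finset.Icc 1 n)
    (h : D.IsForwardDensity L₀ (l + 1)) (hi : i + 1 ≤ l * D.p) :
    Integrable (fun ω => Real.exp (D.lam (i + 1) l * D.increment (i + 1) ω))
      (D.forwardMeasure L₀ (l + 1)) := by
  have hl' := Finset.mem_Icc.1 hl
  have hgrid := D.mem_grid (show l ≤ n + 1 by omega) hi
  obtain ⟨w, hw⟩ := D.exists_setLIntegral_exp_forwardMeasure_eq hL₀ (by omega) h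
    (hi.trans (Nat.mul_le_mul_right _ (Nat.le_succ l))) (@MeasurableSet.univ _ (D.ℱ i))
  have h0 := hw 0
  simp only [zero_mul, Real.exp_zero, ENNReal.ofReal_one, setLIntegral_one, add_zero,
    D.forwardMeasure_univ hL₀ (by omega) h] at h0
  refine ⟨(D.measurable_exp_mul_increment' _ (i + 1)).aestronglyMeasurable, ?_⟩
  rw [hasFiniteIntegral_iff_ofReal (Eventually.of_forall fun _ => (Real.exp_pos _).le)]
  rw [← setLIntegral_univ, hw, ENNReal.sum_lt_top]
  intro S hS
  have hS' := Finset.mem_powerset.1 hS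
  have hS1 : S ⊆ Finset.Icc 1 n := hS'.trans (Finset.Icc_subset_Icc_left (by omega))
  have hlS : l ∉ S := fun hlS => by
    have := (Finset.mem_Icc.1 (hS' hlS)).1
    omega
  -- At `a = 0` the weighted sum is the total mass `1`. As the moments are nonzero, an infinite
  -- weight would contradict this.
  have hwS : w S ≠ ∞ := by
    intro htop
    have hle := Finset.single_le_sum (f := fun S => w S *
      D.expMoment (∑ r ∈ S, D.lam (i + 1) r) (i + 1)) (fun _ _ => zero_le) hS
    rw [← h0] at hle
    simp only [htop, ENNReal.top_mul (D.expMoment_ne_zero _ _)] at hle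
    exact absurd hle (by simp)
  refine ENNReal.mul_lt_top hwS.lt_top (D.expMoment_ne_top hgrid ?_ ?_).lt_top
  · exact add_nonneg (D.sum_lam_nonneg hgrid hS1) (D.lam_pos_of_mem hgrid hl).le
  · have := D.sum_lam_le_totalLam hgrid (Finset.insert_subset hl hS1)
    rw [Finset.sum_insert hlS] at this
    linarith

/-- The conditional exponential moment of an increment under a forward measure is at least the
exponential moment under the terminal measure. -/
theorem expMoment_le_condExp {l i : ℕ} (hl : l ∈ Finset.Icc 1 n)
    (h : D.IsForwardDensity L₀ (l + 1)) (hi : i + 1 ≤ l * D.p) :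
    ∀ᵐ ω ∂(D.forwardMeasure L₀ (l + 1)), (D.expMoment (D.lam (i + 1) l) (i + 1)).toReal ≤
      ((D.forwardMeasure L₀ (l + 1))[fun ω' =>
        Real.exp (D.lam (i + 1) l * D.increment (i + 1) ω') | D.ℱ i]) ω := by
  have hl' := Finset.mem_Icc.1 hl
  have hgrid := D.mem_grid (show l ≤ n + 1 by omega) hi
  have hfin := D.expMoment_lam_ne_top hgrid hl
  have : IsFiniteMeasure (D.forwardMeasure L₀ (l + 1)) :=
    ⟨by simp [D.forwardMeasure_univ hL₀ (by omega) h]⟩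
  refine le_condExp_of_forall_le_setLIntegral (D.ℱ.le i)
    (D.integrable_exp_forwardMeasure hL₀ hl h hi) (fun _ => (Real.exp_pos _).le)
    (ENNReal.toReal_pos (D.expMoment_ne_zero _ _) hfin) fun A hA => ?_
  rw [ENNReal.ofReal_toReal hfin]
  exact D.expMoment_mul_forwardMeasure_le hL₀ hl h hi hA

/-- The rate `L(·, T_l)` is a martingale under `ℙ_{l+1}`. -/
theorem setLIntegral_rate_eq {l i k : ℕ} (hl : l ∈ Finset.Icc 1 n)
    (h : D.IsForwardDensity L₀ (l + 1)) (hik : i ≤ k) (hk : k ≤ l * D.p) {A : Set Ω}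
    (hA : MeasurableSet[D.ℱ i] A) :
    ∫⁻ ω in A, ENNReal.ofReal (D.rate L₀ l k ω) ∂(D.forwardMeasure L₀ (l + 1)) =
      ∫⁻ ω in A, ENNReal.ofReal (D.rate L₀ l i ω) ∂(D.forwardMeasure L₀ (l + 1)) := by
  induction k, hik using Nat.le_induction with
  | base => rfl
  | succ k hik ih =>
    rw [← ih (by omega)]
    have hl' := Finset.mem_Icc.1 hl
    have hgrid := D.mem_grid (show l ≤ n + 1 by omega) hk
    have hlam := D.lam_pos_of_mem hgrid hl
    set Q := D.forwardMeasure L₀ (l + 1) with hQ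
    have : IsFiniteMeasure Q := ⟨by simp [hQ, D.forwardMeasure_univ hL₀ (by omega) h]⟩
    have hAk : MeasurableSet[D.ℱ k] A := D.ℱ.mono hik A hA
    have hA₀ := D.ℱ.le i A hA
    set g : Ω → ℝ := fun ω => D.rate L₀ l k ω *
      Real.exp (D.lam (k + 1) l * D.driftUnder Q l (k + 1) ω) with hg
    have hgm : Measurable[D.ℱ k] g := (D.measurable_rate L₀ l k).mul
      (Real.measurable_exp.comp ((D.measurable_driftUnder Q l (k + 1)).const_mul _))
    have hg₀ : ∀ ω, 0 ≤ g ω := fun ω =>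
      mul_nonneg (D.rate_pos hL₀ hl k ω).le (Real.exp_pos _).le
    have hpull := lintegral_mul_ofReal_condExp (D.ℱ.le k)
      (D.integrable_exp_forwardMeasure hL₀ hl h hk) (D.measurable_exp_mul_increment' _ _)
      (fun _ => (Real.exp_pos _).le) (hgm.ennreal_ofReal.indicator hAk)
    have hind : ∀ (f : Ω → ℝ) ω, A.indicator (fun ω => ENNReal.ofReal (g ω)) ω *
        ENNReal.ofReal (f ω) = A.indicator (fun ω => ENNReal.ofReal (g ω * f ω)) ω := by
      intro f ω
      by_cases hω : ω ∈ A
      · simp only [Set.indicator_of_mem hω, ENNReal.ofReal_mul (hg₀ ω)]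
      · simp [Set.indicator_of_notMem hω]
    rw [lintegral_congr (hind _), lintegral_congr (hind fun ω => Real.exp (D.lam (k + 1) l *
      D.increment (k + 1) ω)), lintegral_indicator hA₀, lintegral_indicator hA₀] at hpull
    simp only [rate_succ]
    refine hpull.symm.trans (lintegral_congr_ae (ae_restrict_of_ae ?_))
    filter_upwards [D.expMoment_le_condExp hL₀ hl h hk] with ω hω
    have hpos := (ENNReal.toReal_pos (D.expMoment_ne_zero _ _)
      (D.expMoment_lam_ne_top hgrid hl)).trans_le hω
    congr 1
    -- The drift is chosen to cancel the conditional moment. The cancellation needs that moment to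
    -- be positive, which the bound from below by the terminal moment supplies.
    have hdrift : Real.exp (D.lam (k + 1) l * D.driftUnder Q l (k + 1) ω) =
        ((Q[fun ω' => Real.exp (D.lam (k + 1) l * D.increment (k + 1) ω') | D.ℱ k]) ω)⁻¹ := by
      rw [driftUnder, Nat.add_sub_cancel, ← mul_assoc, mul_neg, mul_one_div_cancel hlam.ne',
        neg_one_mul, Real.exp_neg, Real.exp_log hpos]
    rw [hg]
    simp only
    rw [hdrift, mul_assoc, inv_mul_cancel₀ hpos.ne', mul_one]

/-- Downward induction. The density of `ℙ_l` with respect to `ℙ_{l+1}` is affine in `L(T_l, T_l)`,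
which on `ℱ_i` may be replaced by `L(t_i, T_l)` thanks to the martingale property. The latter rests
on the induction hypothesis for `l + 1`. -/
theorem isForwardDensity {l : ℕ} (hl : 1 ≤ l) (hln : l ≤ n + 1) : D.IsForwardDensity L₀ l := by
  induction hln using Nat.decreasingInduction with
  | self =>
    intro i _ A _
    simp [forwardMeasure_terminal, densityAt]
  | of_succ l hln ih =>
    have h := ih (by omega)
    have hl' : l ∈ Finset.Icc 1 n := Finset.mem_Icc.2 ⟨hl, by omega⟩
    intro i hi A hA
    have hA₀ := D.ℱ.le i A hA
    have hfac : ∀ k, ∫⁻ ω in A, ENNReal.ofReal (D.densityFactor L₀ l k ω)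
        ∂(D.forwardMeasure L₀ (l + 1)) =
        ∫⁻ ω in A, ENNReal.ofReal (1 / (1 + D.delta * L₀ l)) ∂(D.forwardMeasure L₀ (l + 1)) +
        ENNReal.ofReal (D.delta / (1 + D.delta * L₀ l)) *
          ∫⁻ ω in A, ENNReal.ofReal (D.rate L₀ l k ω) ∂(D.forwardMeasure L₀ (l + 1)) := by
      intro k
      have hpos := D.one_add_delta_mul_pos hL₀ hl'
      rw [← lintegral_const_mul _ (((D.measurable_rate L₀ l k).mono (D.ℱ.le k)
        le_rfl).ennreal_ofReal), ← lintegral_add_left measurable_const]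
      refine lintegral_congr fun ω => ?_
      have hr := (D.rate_pos hL₀ hl' k ω).le
      have hd := D.delta_pos.le
      rw [← ENNReal.ofReal_mul (by positivity), ← ENNReal.ofReal_add (by positivity)
        (by positivity), densityFactor]
      congr 1
      ring
    rw [D.forwardMeasure_eq_withDensity_densityFactor L₀ (show l ≤ n by omega),
      withDensity_apply _ hA₀, hfac, D.setLIntegral_rate_eq hL₀ hl' h hi le_rfl hA, ← hfac,
      ← lintegral_indicator hA₀, D.lintegral_forwardMeasure h
        (hi.trans (Nat.mul_le_mul_right _ (Nat.le_succ l)))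
        ((D.measurable_densityFactor L₀ l i).ennreal_ofReal.indicator hA), ← lintegral_indicator hA₀]
    refine lintegral_congr fun ω => ?_
    by_cases hω : ω ∈ A
    · simp only [Set.indicator_of_mem hω]
      rw [mul_comm, ← ENNReal.ofReal_mul (D.densityFactor_pos hL₀ hl' i ω).le]
      unfold densityAt
      rw [← Finset.insert_Icc_add_one_left_eq_Icc (show l ≤ n by omega),
        Finset.prod_insert (by simp)]
    · simp [Set.indicator_of_notMem hω]

end LiborData

/-! ### Taylor estimates for the exponential in terms of truncated squares and exponential tails. -/

theorem exp_sub_one_sub_le_mul (y : ℝ) : Real.exp y - 1 - y ≤ y * (Real.exp y - 1) := by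
  have h := Real.add_one_le_exp (-y)
  have hmul : Real.exp (-y) * Real.exp y = 1 := by rw [← Real.exp_add]; simp
  nlinarith [Real.exp_pos y]

theorem exp_sub_one_sub_le_sq_mul_exp_abs (y : ℝ) :
    Real.exp y - 1 - y ≤ y ^ 2 * Real.exp |y| := by
  refine (exp_sub_one_sub_le_mul y).trans ?_
  have h := Real.add_one_le_exp (-y)
  have h' := Real.add_one_le_exp y
  have hmul : Real.exp (-y) * Real.exp y = 1 := by rw [← Real.exp_add]; simp
  rcases le_total 0 y with hy | hy
  · rw [abs_of_nonneg hy, sq, mul_assoc]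
    refine mul_le_mul_of_nonneg_left ?_ hy
    nlinarith [Real.exp_pos y]
  · have h1 : 1 ≤ Real.exp |y| := Real.one_le_exp (abs_nonneg y)
    nlinarith [sq_nonneg y]

theorem exp_sub_one_sub_le_abs_mul_exp_abs (y : ℝ) :
    Real.exp y - 1 - y ≤ |y| * Real.exp |y| := by
  refine (exp_sub_one_sub_le_mul y).trans ?_
  rcases le_total 0 y with hy | hy
  · rw [abs_of_nonneg hy]
    nlinarith
  · have h1 : 1 ≤ Real.exp |y| := Real.one_le_exp (abs_nonneg y)
    rw [abs_of_nonpos hy] at *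
    nlinarith [Real.exp_pos y]

/-- The function `x² ∧ 1` plus exponential tails of order `K`. -/
def truncSqExp (K x : ℝ) : ℝ :=
  min (x ^ 2) 1 + {x : ℝ | 1 < |x|}.indicator (fun x => Real.exp (K * x) + Real.exp (-K * x)) x

theorem measurableSet_one_lt_abs : MeasurableSet {x : ℝ | 1 < |x|} :=
  measurableSet_lt measurable_const measurable_id.abs

theorem measurable_truncSqExp (K : ℝ) : Measurable (truncSqExp K) := by
  refine ((measurable_id.pow_const 2).min measurable_const).add
    (Measurable.indicator ?_ measurableSet_one_lt_abs)
  fun_prop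

theorem truncSqExp_of_abs_le_one (K : ℝ) {x : ℝ} (hx : |x| ≤ 1) : truncSqExp K x = x ^ 2 := by
  rw [truncSqExp, Set.indicator_of_notMem (by simpa using hx), add_zero,
    min_eq_left ((sq_le_one_iff_abs_le_one x).2 hx)]

theorem truncSqExp_nonneg (K x : ℝ) : 0 ≤ truncSqExp K x :=
  add_nonneg (le_min (sq_nonneg x) zero_le_one)
    (Set.indicator_nonneg (fun _ _ => by positivity) x)

theorem exp_mul_abs_le_truncSqExp (K : ℝ) {x : ℝ} (hx : 1 < |x|) :
    Real.exp (K * |x|) ≤ truncSqExp K x := by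
  rw [truncSqExp, Set.indicator_of_mem (show x ∈ {x : ℝ | 1 < |x|} from hx)]
  have h0 : 0 ≤ min (x ^ 2) 1 := le_min (sq_nonneg x) zero_le_one
  rcases abs_choice x with h | h <;> rw [h]
  · linarith [Real.exp_pos (-K * x)]
  · rw [show K * -x = -K * x by ring]
    linarith [Real.exp_pos (K * x)]

/-- The factor `l` is kept because it is divided out later and volatilities have no positive lower
bound. For large `|x|` this leaves a factor `|x|`, absorbed by `exp (ε M |x|) / (ε M)`; this is
where tails of order beyond `M` are used. -/
theorem exp_sub_one_sub_le_mul_truncSqExp {l M ε : ℝ} (hl : 0 < l) (hlM : l ≤ M) (hε : 0 < ε)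
    (x : ℝ) : Real.exp (l * x) - 1 - l * x ≤
      l * ((M * Real.exp M + 1 / (ε * M)) * truncSqExp ((1 + ε) * M) x) := by
  have hM : 0 < M := hl.trans_le hlM
  have hT := truncSqExp_nonneg ((1 + ε) * M) x
  have habs : |l * x| = l * |x| := by rw [abs_mul, abs_of_pos hl]
  rcases le_or_gt |x| 1 with hx | hx
  · calc Real.exp (l * x) - 1 - l * x ≤ (l * x) ^ 2 * Real.exp |l * x| :=
        exp_sub_one_sub_le_sq_mul_exp_abs _
      _ = l * (l * Real.exp (l * |x|) * x ^ 2) := by rw [habs]; ring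
      _ ≤ l * (M * Real.exp M * x ^ 2) := by
        have : l * |x| ≤ M := (mul_le_of_le_one_right hl.le hx).trans hlM
        gcongr
      _ ≤ l * ((M * Real.exp M + 1 / (ε * M)) * x ^ 2) := by
        have : 0 ≤ 1 / (ε * M) := by positivity
        gcongr
        linarith
      _ = _ := by rw [truncSqExp_of_abs_le_one _ hx]
  · have h1 : |x| ≤ 1 / (ε * M) * Real.exp (ε * M * |x|) := by
      rw [one_div, inv_mul_eq_div, le_div_iff₀ (by positivity)]
      linarith [Real.add_one_le_exp (ε * M * |x|)]
    calc Real.exp (l * x) - 1 - l * x ≤ |l * x| * Real.exp |l * x| :=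
        exp_sub_one_sub_le_abs_mul_exp_abs _
      _ = l * (|x| * Real.exp (l * |x|)) := by rw [habs]; ring
      _ ≤ l * (1 / (ε * M) * Real.exp (ε * M * |x|) * Real.exp (M * |x|)) := by gcongr
      _ = l * (1 / (ε * M) * Real.exp ((1 + ε) * M * |x|)) := by
        rw [mul_assoc (1 / (ε * M)), ← Real.exp_add]
        ring_nf
      _ ≤ l * (1 / (ε * M) * truncSqExp ((1 + ε) * M) x) := by
        gcongr
        exact exp_mul_abs_le_truncSqExp _ hx
      _ ≤ _ := by
        have : 0 ≤ M * Real.exp M := by positivity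
        gcongr
        linarith

/-- Here no factor `c` has to survive, so for large `|x|` the left side is simply at most `exp (c
|x|)`, and the order may go all the way up to `K`. -/
theorem exp_sub_one_sub_le_const_mul_truncSqExp {c K : ℝ} (hc : 0 ≤ c) (hcK : c ≤ K) (x : ℝ) :
    Real.exp (c * x) - 1 - c * x ≤ (K ^ 2 * Real.exp K + 1) * truncSqExp K x := by
  have hK : 0 ≤ K := hc.trans hcK
  have habs : |c * x| = c * |x| := by rw [abs_mul, abs_of_nonneg hc]
  rcases le_or_gt |x| 1 with hx | hx
  · rw [truncSqExp_of_abs_le_one _ hx]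
    calc Real.exp (c * x) - 1 - c * x ≤ (c * x) ^ 2 * Real.exp |c * x| :=
        exp_sub_one_sub_le_sq_mul_exp_abs _
      _ = c ^ 2 * Real.exp (c * |x|) * x ^ 2 := by rw [habs]; ring
      _ ≤ K ^ 2 * Real.exp K * x ^ 2 := by
        have : c * |x| ≤ K := (mul_le_of_le_one_right hc hx).trans hcK
        gcongr
      _ ≤ _ := by nlinarith [sq_nonneg x]
  · have h1 : Real.exp (c * x) - 1 - c * x ≤ Real.exp (c * |x|) := by
      rcases le_total 0 x with h | h
      · rw [abs_of_nonneg h]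
        linarith [mul_nonneg hc h]
      · rw [abs_of_nonpos h]
        have := Real.add_one_le_exp (c * -x)
        have := Real.exp_le_one_iff.2 (mul_nonpos_of_nonneg_of_nonpos hc h)
        linarith
    have h2 : Real.exp (c * |x|) ≤ Real.exp (K * |x|) := by gcongr
    have h3 := exp_mul_abs_le_truncSqExp K hx
    have h4 : 0 ≤ K ^ 2 * Real.exp K * truncSqExp K x :=
      mul_nonneg (by positivity) (truncSqExp_nonneg K x)
    linarith

/-! ### Mean and exponential moments of a law normalized at one exponential order. -/

section Moments

variable {ν : Measure ℝ} [IsProbabilityMeasure ν] {K : ℝ}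

theorem integrable_exp_mul_of_truncSqExp (hT : Integrable (truncSqExp K) ν) {c : ℝ} (hc : 0 ≤ c)
    (hcK : c ≤ K) : Integrable (fun x => Real.exp (c * x)) ν := by
  refine ((integrable_const (Real.exp K)).add hT).mono' (by fun_prop) (Eventually.of_forall ?_)
  intro x
  rw [Real.norm_of_nonneg (Real.exp_pos _).le, Pi.add_apply]
  have hx' : c * x ≤ c * |x| := mul_le_mul_of_nonneg_left (le_abs_self x) hc
  rcases le_or_gt |x| 1 with hx | hx
  · have : c * x ≤ K := hx'.trans ((mul_le_of_le_one_right hc hx).trans hcK)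
    linarith [Real.exp_le_exp.2 this, truncSqExp_nonneg K x]
  · have : c * x ≤ K * |x| := hx'.trans (by gcongr)
    linarith [Real.exp_le_exp.2 this, exp_mul_abs_le_truncSqExp K hx, Real.exp_pos K]

theorem integrable_id_of_truncSqExp (hK : 0 < K) (hT : Integrable (truncSqExp K) ν) :
    Integrable (fun x : ℝ => x) ν := by
  refine ((integrable_const (1 : ℝ)).add (hT.const_mul (1 / K))).mono' (by fun_prop)
    (Eventually.of_forall ?_)
  intro x
  rw [Real.norm_eq_abs, Pi.add_apply]
  rcases le_or_gt |x| 1 with hx | hx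
  · have := truncSqExp_nonneg K x
    have : 0 ≤ 1 / K * truncSqExp K x := by positivity
    linarith
  · have h1 : |x| ≤ 1 / K * Real.exp (K * |x|) := by
      rw [one_div, inv_mul_eq_div, le_div_iff₀ hK]
      linarith [Real.add_one_le_exp (K * |x|)]
    have h2 : 1 / K * Real.exp (K * |x|) ≤ 1 / K * truncSqExp K x := by
      gcongr
      exact exp_mul_abs_le_truncSqExp K hx
    linarith

variable {l M ε : ℝ}

theorem integral_nonpos_of_integral_exp_eq_one (hK : 0 < K) (hl : 0 < l) (hlK : l ≤ K)
    (hT : Integrable (truncSqExp K) ν) (hone : ∫ x, Real.exp (l * x) ∂ν = 1) :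
    ∫ x, x ∂ν ≤ 0 := by
  have hid := integrable_id_of_truncSqExp hK hT
  have hmono := integral_mono ((hid.const_mul l).add (integrable_const 1))
    (integrable_exp_mul_of_truncSqExp hT hl.le hlK) (fun x => Real.add_one_le_exp (l * x))
  simp only [Pi.add_apply] at hmono
  rw [integral_add (hid.const_mul l) (integrable_const 1), integral_const_mul, hone] at hmono
  simp only [integral_const, probReal_univ, one_smul] at hmono
  nlinarith

/-- Integrating the Taylor estimate, the normalization leaves only `-l` times the mean on the left.
Cancelling `l` gives a constant that does not blow up as `l` tends to `0`. -/
theorem neg_integral_le_of_integral_exp_eq_one (hl : 0 < l) (hlM : l ≤ M) (hε : 0 < ε)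
    (hT : Integrable (truncSqExp ((1 + ε) * M)) ν) (hone : ∫ x, Real.exp (l * x) ∂ν = 1) :
    -∫ x, x ∂ν ≤ (M * Real.exp M + 1 / (ε * M)) * ∫ x, truncSqExp ((1 + ε) * M) x ∂ν := by
  have hM : 0 < M := hl.trans_le hlM
  have hMK : M ≤ (1 + ε) * M := by nlinarith
  have hid := integrable_id_of_truncSqExp (by positivity) hT
  have hexp := integrable_exp_mul_of_truncSqExp hT hl.le (hlM.trans hMK)
  have hmono := integral_mono ((hexp.sub (integrable_const 1)).sub (hid.const_mul l))
    ((hT.const_mul (M * Real.exp M + 1 / (ε * M))).const_mul l)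
    (fun x => exp_sub_one_sub_le_mul_truncSqExp hl hlM hε x)
  simp only [Pi.sub_apply] at hmono
  rw [integral_sub (f := fun x => Real.exp (l * x) - 1) (hexp.sub (integrable_const 1))
    (hid.const_mul l), integral_const_mul, integral_sub hexp (integrable_const 1), integral_const_mul, integral_const_mul, hone] at hmono
  simp only [integral_const, probReal_univ, one_smul, sub_self, zero_sub] at hmono
  rw [← mul_neg] at hmono
  exact le_of_mul_le_mul_left hmono hl

/-- The linear Taylor term contributes `c` times the mean, which is nonpositive and can be dropped;
then `1 + z ≤ exp z`. The exponential form is what multiplies well over time steps. -/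
theorem integral_exp_le_of_integral_nonpos {c : ℝ} (hK : 0 < K) (hc : 0 ≤ c) (hcK : c ≤ K)
    (hT : Integrable (truncSqExp K) ν) (hneg : ∫ x, x ∂ν ≤ 0) :
    ∫ x, Real.exp (c * x) ∂ν ≤
      Real.exp ((K ^ 2 * Real.exp K + 1) * ∫ x, truncSqExp K x ∂ν) := by
  have hid := integrable_id_of_truncSqExp hK hT
  have hexp := integrable_exp_mul_of_truncSqExp hT hc hcK
  have hmono := integral_mono ((hexp.sub (integrable_const 1)).sub (hid.const_mul c))
    (hT.const_mul (K ^ 2 * Real.exp K + 1))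
    (fun x => exp_sub_one_sub_le_const_mul_truncSqExp hc hcK x)
  simp only [Pi.sub_apply] at hmono
  rw [integral_sub (f := fun x => Real.exp (c * x) - 1) (hexp.sub (integrable_const 1))
    (hid.const_mul c), integral_const_mul, integral_sub hexp (integrable_const 1), integral_const_mul] at hmono
  simp only [integral_const, probReal_univ, one_smul] at hmono
  have h1 := Real.add_one_le_exp ((K ^ 2 * Real.exp K + 1) * ∫ x, truncSqExp K x ∂ν)
  nlinarith [mul_nonneg hc (neg_nonneg.2 hneg)]

theorem mul_integral_le_log_integral_exp {c : ℝ} (hid : Integrable (fun x : ℝ => x) ν)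
    (hexp : Integrable (fun x => Real.exp (c * x)) ν) :
    c * ∫ x, x ∂ν ≤ Real.log (∫ x, Real.exp (c * x) ∂ν) := by
  rw [Real.le_log_iff_exp_le (integral_exp_pos hexp), ← integral_const_mul]
  exact convexOn_exp.map_integral_le Real.continuous_exp.continuousOn isClosed_univ
    (Eventually.of_forall fun _ => Set.mem_univ _) (hid.const_mul c) hexp

end Moments

/-! ### The moment bound for one time step. -/

namespace LiborData

variable {n : ℕ} {Ω : Type*} [MeasurableSpace Ω] (D : LiborData n Ω)

/-- The logarithmic exponential moment `log E exp (λ_{ij} U_i)` under the terminal measure. -/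
def logMoment (i j : ℕ) : ℝ := Real.log (D.expMoment (D.lam i j) i).toReal

/-- The almost sure value of the drift of the last rate under the terminal measure. -/
def terminalDrift (i : ℕ) : ℝ := -(1 / D.lam i n) * D.logMoment i n

theorem driftUnder_terminal_ae_eq (i : ℕ) :
    ∀ᵐ ω ∂D.P, D.driftUnder D.P n (i + 1) ω = D.terminalDrift (i + 1) := by
  have hU : Measurable fun ω => D.X (i + 1) ω - D.X i ω := D.measurable_increment' (i + 1)
  have hcomap : Measurable[MeasurableSpace.comap (fun ω => D.X (i + 1) ω - D.X i ω) (borel ℝ)]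
      fun ω => Real.exp (D.lam (i + 1) n * D.increment (i + 1) ω) :=
    Real.measurable_exp.comp (Measurable.const_mul (comap_measurable _) _)
  filter_upwards [condExp_indep_eq hU.comap_le (D.ℱ.le i) hcomap.stronglyMeasurable
    (D.indep_increments i)] with ω hω
  rw [driftUnder, Nat.add_sub_cancel, hω, integral_eq_lintegral_of_nonneg_ae
    (Eventually.of_forall fun _ => (Real.exp_pos _).le)
    (D.measurable_exp_mul_increment' _ _).aestronglyMeasurable]
  rfl

theorem compensator_eq_map {i : ℕ} (hi : 1 ≤ i) :
    D.compensator i = D.P.map fun ω => D.increment i ω + D.terminalDrift i := by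
  obtain ⟨i, rfl⟩ := Nat.exists_eq_add_of_le' hi
  refine Measure.map_congr ?_
  filter_upwards [D.driftUnder_terminal_ae_eq i] with ω hω
  rw [hω]

theorem isProbabilityMeasure_compensator {i : ℕ} (hi : 1 ≤ i) :
    IsProbabilityMeasure (D.compensator i) := by
  rw [D.compensator_eq_map hi]
  exact Measure.isProbabilityMeasure_map ((D.measurable_increment' i).add_const _).aemeasurable

theorem expMoment_eq_lintegral_compensator {i : ℕ} (hi : 1 ≤ i) (c : ℝ) :
    D.expMoment c i = ENNReal.ofReal (Real.exp (-(c * D.terminalDrift i))) *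
      ∫⁻ x, ENNReal.ofReal (Real.exp (c * x)) ∂(D.compensator i) := by
  rw [D.compensator_eq_map hi, lintegral_map (by fun_prop)
    ((D.measurable_increment' i).add_const _), ← lintegral_const_mul]
  · refine lintegral_congr fun ω => ?_
    rw [← ENNReal.ofReal_mul (Real.exp_pos _).le, ← Real.exp_add]
    ring_nf
  · exact (Real.measurable_exp.comp
      (((D.measurable_increment' i).add_const _).const_mul _)).ennreal_ofReal

variable {i : ℕ} (hi : i ∈ Finset.Icc 1 ((n + 1) * D.p))
include hi

theorem expMoment_eq_ofReal {c : ℝ}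
    (h : Integrable (fun x => Real.exp (c * x)) (D.compensator i)) :
    D.expMoment c i = ENNReal.ofReal (Real.exp (-(c * D.terminalDrift i)) *
      ∫ x, Real.exp (c * x) ∂(D.compensator i)) := by
  rw [D.expMoment_eq_lintegral_compensator (Finset.mem_Icc.1 hi).1,
    ENNReal.ofReal_mul (Real.exp_pos _).le,
    ofReal_integral_eq_lintegral_ofReal h (Eventually.of_forall fun _ => (Real.exp_pos _).le)]

theorem logMoment_eq {j : ℕ}
    (h : Integrable (fun x => Real.exp (D.lam i j * x)) (D.compensator i)) :
    D.logMoment i j = -(D.lam i j * D.terminalDrift i) +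
      Real.log (∫ x, Real.exp (D.lam i j * x) ∂(D.compensator i)) := by
  have := D.isProbabilityMeasure_compensator (Finset.mem_Icc.1 hi).1
  have hpos := integral_exp_pos h
  rw [logMoment, D.expMoment_eq_ofReal hi h, ENNReal.toReal_ofReal
    (mul_nonneg (Real.exp_pos _).le hpos.le), Real.log_mul (Real.exp_pos _).ne' hpos.ne',
    Real.log_exp]

/-- The drift of the last rate cancels its own logarithmic moment. This normalization is what
controls the mean of the jump law. -/
theorem integral_exp_compensator_eq_one (hn : 1 ≤ n)
    (h : Integrable (fun x => Real.exp (D.lam i n * x)) (D.compensator i)) :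
    ∫ x, Real.exp (D.lam i n * x) ∂(D.compensator i) = 1 := by
  have := D.isProbabilityMeasure_compensator (Finset.mem_Icc.1 hi).1
  have hlam := D.lam_pos_of_mem hi (Finset.right_mem_Icc.2 hn)
  have hlog := D.logMoment_eq hi h
  rw [terminalDrift, ← mul_assoc, mul_neg, mul_one_div_cancel hlam.ne'] at hlog
  exact Real.eq_one_of_pos_of_log_eq_zero (integral_exp_pos h) (by linarith)

/-- A moment bound for one time step: the exponential moment of order `1 + ε` of the products of the
normalized factors `exp (λ_{ij} U_i) / E exp (λ_{ij} U_i)`. -/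
theorem expMoment_mul_exp_logMoment_le {M ε : ℝ} (hn : 1 ≤ n) (hε : 0 < ε)
    (hM : D.totalLam i ≤ M) (hT : Integrable (truncSqExp ((1 + ε) * M)) (D.compensator i))
    {S : Finset ℕ} (hS : S ⊆ Finset.Icc 1 n) :
    D.expMoment ((1 + ε) * ∑ j ∈ S, D.lam i j) i *
      ENNReal.ofReal (Real.exp (-((1 + ε) * ∑ j ∈ S, D.logMoment i j))) ≤
      ENNReal.ofReal (Real.exp (((((1 + ε) * M) ^ 2 * Real.exp ((1 + ε) * M) + 1) +
        (1 + ε) * M * (M * Real.exp M + 1 / (ε * M))) *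
        ∫ x, truncSqExp ((1 + ε) * M) x ∂(D.compensator i))) := by
  have := D.isProbabilityMeasure_compensator (Finset.mem_Icc.1 hi).1
  have hnmem := Finset.right_mem_Icc.2 hn
  have hlampos := D.lam_pos_of_mem hi hnmem
  have hle : ∀ j ∈ Finset.Icc 1 n, D.lam i j ≤ M := fun j hj => by
    simpa using (D.sum_lam_le_totalLam hi (Finset.singleton_subset_iff.2 hj)).trans hM
  have hMpos : 0 < M := hlampos.trans_le (hle n hnmem)
  have hMK : M ≤ (1 + ε) * M := by nlinarith
  have hK : 0 < (1 + ε) * M := hMpos.trans_le hMK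
  have hint : ∀ j ∈ Finset.Icc 1 n,
      Integrable (fun x => Real.exp (D.lam i j * x)) (D.compensator i) := fun j hj =>
    integrable_exp_mul_of_truncSqExp hT (D.lam_pos_of_mem hi hj).le ((hle j hj).trans hMK)
  have hone := D.integral_exp_compensator_eq_one hi hn (hint n hnmem)
  have hneg := integral_nonpos_of_integral_exp_eq_one hK hlampos ((hle n hnmem).trans hMK) hT hone
  have hlow := neg_integral_le_of_integral_exp_eq_one hlampos (hle n hnmem) hε hT hone
  have hid := integrable_id_of_truncSqExp hK hT
  set c := (1 + ε) * ∑ j ∈ S, D.lam i j with hc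
  set σ := ∫ x, truncSqExp ((1 + ε) * M) x ∂(D.compensator i) with hσ
  set m := ∫ x, x ∂(D.compensator i) with hm
  have hc₀ : 0 ≤ c := mul_nonneg (by linarith) (D.sum_lam_nonneg hi hS)
  have hcK : c ≤ (1 + ε) * M :=
    mul_le_mul_of_nonneg_left ((D.sum_lam_le_totalLam hi hS).trans hM) (by linarith)
  -- Jensen's inequality for each rate. The term in the terminal drift, which has no bound of its
  -- own, cancels the one produced by translating `U_i` in the moment of order `c`.
  have hlog : c * m - c * D.terminalDrift i ≤ (1 + ε) * ∑ j ∈ S, D.logMoment i j := by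
    rw [hc, mul_assoc, mul_assoc, ← mul_sub, ← mul_sub, Finset.sum_mul]
    refine mul_le_mul_of_nonneg_left (Finset.sum_le_sum fun j hj => ?_) (by linarith)
    rw [D.logMoment_eq hi (hint j (hS hj))]
    have := mul_integral_le_log_integral_exp hid (hint j (hS hj))
    linarith
  rw [D.expMoment_eq_ofReal hi (integrable_exp_mul_of_truncSqExp hT hc₀ hcK),
    ← ENNReal.ofReal_mul (mul_nonneg (Real.exp_pos _).le
      (integral_nonneg fun _ => (Real.exp_pos _).le))]
  refine ENNReal.ofReal_le_ofReal ?_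
  have hupper := integral_exp_le_of_integral_nonpos hK hc₀ hcK hT hneg
  calc Real.exp (-(c * D.terminalDrift i)) * (∫ x, Real.exp (c * x) ∂(D.compensator i)) *
        Real.exp (-((1 + ε) * ∑ j ∈ S, D.logMoment i j))
      ≤ Real.exp (-(c * D.terminalDrift i)) *
        Real.exp ((((1 + ε) * M) ^ 2 * Real.exp ((1 + ε) * M) + 1) * σ) *
        Real.exp (-(c * m - c * D.terminalDrift i)) := by gcongr
    _ = Real.exp ((((1 + ε) * M) ^ 2 * Real.exp ((1 + ε) * M) + 1) * σ + c * -m) := by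
      rw [← Real.exp_add, ← Real.exp_add]
      ring_nf
    _ ≤ _ := by
      refine Real.exp_le_exp.2 ?_
      have h1 : c * -m ≤ (1 + ε) * M * -m := mul_le_mul_of_nonneg_right hcK (by linarith)
      have h2 := mul_le_mul_of_nonneg_left hlow hK.le
      linarith

end LiborData

/-! ### Splitting the tail functional, and Hölder's inequality for densities. -/

theorem lintegral_truncSqExp (K : ℝ) (ν : Measure ℝ) :
    ∫⁻ x, ENNReal.ofReal (truncSqExp K x) ∂ν =
      ∫⁻ x, ENNReal.ofReal (min (x ^ 2) 1) ∂ν +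
        (∫⁻ x in {x : ℝ | 1 < |x|}, ENNReal.ofReal (Real.exp (K * x)) ∂ν +
          ∫⁻ x in {x : ℝ | 1 < |x|}, ENNReal.ofReal (Real.exp (-K * x)) ∂ν) := by
  rw [← lintegral_add_left (by fun_prop), ← lintegral_indicator measurableSet_one_lt_abs,
    ← lintegral_add_left (by fun_prop)]
  refine lintegral_congr fun x => ?_
  rw [truncSqExp, ENNReal.ofReal_add (le_min (sq_nonneg x) zero_le_one)
    (Set.indicator_nonneg (fun _ _ => by positivity) x)]
  congr 1
  by_cases hx : x ∈ {x : ℝ | 1 < |x|}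
  · rw [Set.indicator_of_mem hx, Set.indicator_of_mem hx,
      ENNReal.ofReal_add (Real.exp_pos _).le (Real.exp_pos _).le]
  · rw [Set.indicator_of_notMem hx, Set.indicator_of_notMem hx, ENNReal.ofReal_zero]

theorem withDensity_apply_le_of_lintegral_rpow {Ω : Type*} [MeasurableSpace Ω] {μ : Measure Ω}
    {Z : Ω → ℝ≥0∞} (hZ : Measurable Z) {q : ℝ} (hq : 1 < q) {A : Set Ω} (hA : MeasurableSet A) :
    μ.withDensity Z A ≤ (∫⁻ ω, Z ω ^ q ∂μ) ^ (1 / q) * μ A ^ (1 / q.conjExponent) := by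
  have hconj := Real.HolderConjugate.conjExponent hq
  have h := ENNReal.lintegral_mul_le_Lp_mul_Lq μ hconj hZ.aemeasurable
    ((measurable_one.indicator hA : Measurable (A.indicator (1 : Ω → ℝ≥0∞))).aemeasurable)
  have h1 : ∀ ω, A.indicator (1 : Ω → ℝ≥0∞) ω ^ q.conjExponent = A.indicator 1 ω := by
    intro ω
    by_cases hω : ω ∈ A
    · simp [Set.indicator_of_mem hω]
    · simp [Set.indicator_of_notMem hω, hconj.symm.pos]
  simp only [h1, lintegral_indicator_one hA] at h
  refine le_trans (le_of_eq ?_) h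
  rw [withDensity_apply _ hA, ← lintegral_indicator hA]
  refine lintegral_congr fun ω => ?_
  by_cases hω : ω ∈ A
  · simp [Set.indicator_of_mem hω]
  · simp [Set.indicator_of_notMem hω]

/-! ### Uniform moment bound for the densities of the forward measures. -/

namespace LiborData

/-- A bound for the moment of order `1 + ε` of the density of the forward measure `ℙ_l`. -/
def momentBound (n : ℕ) (L₀ : ℕ → ℝ) (M ε B : ℝ) (l : ℕ) : ℝ≥0∞ :=
  (∏ _r ∈ Finset.Icc l n, (2 : ℝ≥0∞) ^ (1 + ε - 1)) * ∑ S ∈ (Finset.Icc l n).powerset,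
    (∏ r ∈ S, ENNReal.ofReal (L₀ r ^ (1 + ε))) *
    ENNReal.ofReal (Real.exp (((((1 + ε) * M) ^ 2 * Real.exp ((1 + ε) * M) + 1) +
      (1 + ε) * M * (M * Real.exp M + 1 / (ε * M))) * B))

theorem momentBound_ne_top (n : ℕ) (L₀ : ℕ → ℝ) (M ε B : ℝ) (l : ℕ) :
    momentBound n L₀ M ε B l ≠ ∞ := by
  refine ENNReal.mul_ne_top (ENNReal.prod_ne_top fun _ _ => by simp) ?_
  exact ENNReal.sum_ne_top.2 fun S _ => ENNReal.mul_ne_top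
    (ENNReal.prod_ne_top fun _ _ => ENNReal.ofReal_ne_top) ENNReal.ofReal_ne_top

variable {n : ℕ} {Ω : Type*} [MeasurableSpace Ω] (D : LiborData n Ω) {L₀ : ℕ → ℝ}

variable (L₀) in
theorem measurable_prod_densityFactor (l : ℕ) : Measurable (∏ r ∈ Finset.Icc l n, fun ω =>
    ENNReal.ofReal (D.densityFactor L₀ r (r * D.p) ω)) := by
  rw [Finset.prod_fn]
  exact Finset.measurable_prod _ fun r _ => (D.measurable_densityFactor' L₀ r _).ennreal_ofReal

/-- Unlike in `densityAt`, each factor is taken at its own maturity `T_r`, so this is the density on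
the whole σ-algebra. -/
theorem forwardMeasure_eq_withDensity_terminal {l : ℕ} (hln : l ≤ n + 1) :
    D.forwardMeasure L₀ l = D.P.withDensity
      (∏ r ∈ Finset.Icc l n, fun ω => ENNReal.ofReal (D.densityFactor L₀ r (r * D.p) ω)) := by
  induction hln using Nat.decreasingInduction with
  | self => simp [forwardMeasure_terminal]
  | of_succ l hln ih =>
    rw [D.forwardMeasure_eq_withDensity_densityFactor L₀ (show l ≤ n by omega), ih,
      ← Finset.insert_Icc_add_one_left_eq_Icc (show l ≤ n by omega), Finset.prod_insert (by simp),
      mul_comm (fun ω => ENNReal.ofReal _)]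
    refine (withDensity_mul _ ?_ (D.measurable_densityFactor' L₀ _ _).ennreal_ofReal).symm
    exact D.measurable_prod_densityFactor L₀ (l + 1)

/-- The upper bound of the rate `L(t_k, T_r)` obtained by replacing the random drift by a
deterministic one. -/
def rateBound (L₀ : ℕ → ℝ) (r k : ℕ) (ω : Ω) : ℝ :=
  L₀ r * Real.exp (∑ u ∈ Finset.Icc 1 k, (D.lam u r * D.increment u ω - D.logMoment u r))

theorem rateBound_rpow (q : ℝ) (r k : ℕ) (ω : Ω) (hL : 0 < L₀ r) :
    ENNReal.ofReal (D.rateBound L₀ r k ω) ^ q = ENNReal.ofReal (L₀ r ^ q) *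
      ENNReal.ofReal (Real.exp (q * ∑ u ∈ Finset.Icc 1 k,
        (D.lam u r * D.increment u ω - D.logMoment u r))) := by
  rw [rateBound, ENNReal.ofReal_rpow_of_pos (mul_pos hL (Real.exp_pos _)),
    Real.mul_rpow hL.le (Real.exp_pos _).le, ← Real.exp_mul, mul_comm _ q,
    ENNReal.ofReal_mul (Real.rpow_nonneg hL.le q)]

theorem measurable_rateBound (r k : ℕ) : Measurable (D.rateBound L₀ r k) := by
  refine (Real.measurable_exp.comp (Finset.measurable_fun_sum _ fun u _ => ?_)).const_mul _
  exact ((D.measurable_increment' u).const_mul _).sub_const _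

variable (hL₀ : ∀ j ∈ Finset.Icc 1 n, 0 < L₀ j)
include hL₀

theorem absolutelyContinuous_forwardMeasure {l : ℕ} (hl : 1 ≤ l) (hln : l ≤ n + 1) :
    D.P ≪ D.forwardMeasure L₀ l := by
  refine Measure.AbsolutelyContinuous.mk fun A hA h0 => ?_
  have := D.measure_le_forwardMeasure hL₀ hl hln A hA
  rwa [h0, mul_zero, nonpos_iff_eq_zero] at this

/-- The drift decreases in the conditional moment, which is at least the terminal one. That bound
holds almost everywhere for `ℙ_{r+1}` and passes to the terminal measure by absolute continuity. -/
theorem rate_le_rateBound {r k : ℕ} (hr : r ∈ Finset.Icc 1 n) (hk : k ≤ r * D.p) :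
    ∀ᵐ ω ∂D.P, D.rate L₀ r k ω ≤ D.rateBound L₀ r k ω := by
  have hr' := Finset.mem_Icc.1 hr
  have hdrift : ∀ u ∈ Finset.Icc 1 k, ∀ᵐ ω ∂D.P,
      D.lam u r * D.driftUnder (D.forwardMeasure L₀ (r + 1)) r u ω ≤ -D.logMoment u r := by
    intro u hu
    have hu' := Finset.mem_Icc.1 hu
    obtain ⟨u, rfl⟩ := Nat.exists_eq_add_of_le' hu'.1
    have hgrid := D.mem_grid (show r ≤ n + 1 by omega) (hu'.2.trans hk)
    filter_upwards [(D.absolutelyContinuous_forwardMeasure hL₀ (show 1 ≤ r + 1 by omega)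
      (by omega)).ae_le (D.expMoment_le_condExp hL₀ hr
        (D.isForwardDensity hL₀ (by omega) (by omega)) (hu'.2.trans hk))] with ω hω
    rw [driftUnder, Nat.add_sub_cancel, ← mul_assoc, mul_neg,
      mul_one_div_cancel (D.lam_pos_of_mem hgrid hr).ne', neg_one_mul]
    exact neg_le_neg (Real.log_le_log (ENNReal.toReal_pos (D.expMoment_ne_zero _ _)
      (D.expMoment_lam_ne_top hgrid hr)) hω)
  filter_upwards [(Filter.eventually_all_finset _).2 hdrift] with ω hω
  refine mul_le_mul_of_nonneg_left (Real.exp_le_exp.2 (Finset.sum_le_sum fun u hu => ?_))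
    (hL₀ r hr).le
  rw [mul_add]
  linarith [hω u hu]

theorem densityFactor_le_rateBound {r : ℕ} (hr : r ∈ Finset.Icc 1 n) :
    ∀ᵐ ω ∂D.P, ENNReal.ofReal (D.densityFactor L₀ r (r * D.p) ω) ≤
      1 + ENNReal.ofReal (D.rateBound L₀ r (r * D.p) ω) := by
  filter_upwards [D.rate_le_rateBound hL₀ hr le_rfl] with ω hω
  have hpos := D.rate_pos hL₀ hr (r * D.p) ω
  rw [← ENNReal.ofReal_one, ← ENNReal.ofReal_add zero_le_one (hpos.le.trans hω)]
  refine ENNReal.ofReal_le_ofReal ?_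
  have h1 : D.delta * D.rate L₀ r (r * D.p) ω ≤ D.rate L₀ r (r * D.p) ω :=
    mul_le_of_le_one_left hpos.le D.delta_le_one
  have h2 := mul_pos D.delta_pos (hL₀ r hr)
  have h3 := mul_pos D.delta_pos hpos
  rw [densityFactor]
  refine (div_le_self (by linarith) (by linarith)).trans (by linarith)

theorem lintegral_prod_rateBound_rpow_le {M ε : ℝ} (hn : 1 ≤ n) (hε : 0 < ε)
    (hM : ∀ i ∈ Finset.Icc 1 ((n + 1) * D.p), D.totalLam i ≤ M)
    (hT : ∀ i ∈ Finset.Icc 1 ((n + 1) * D.p),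
      Integrable (truncSqExp ((1 + ε) * M)) (D.compensator i))
    {S : Finset ℕ} (hS : S ⊆ Finset.Icc 1 n) :
    ∫⁻ ω, ∏ r ∈ S, ENNReal.ofReal (D.rateBound L₀ r (r * D.p) ω) ^ (1 + ε) ∂D.P ≤
      (∏ r ∈ S, ENNReal.ofReal (L₀ r ^ (1 + ε))) *
      ENNReal.ofReal (Real.exp (((((1 + ε) * M) ^ 2 * Real.exp ((1 + ε) * M) + 1) +
        (1 + ε) * M * (M * Real.exp M + 1 / (ε * M))) *
        ∑ i ∈ Finset.Icc 1 ((n + 1) * D.p),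
          ∫ x, truncSqExp ((1 + ε) * M) x ∂(D.compensator i))) := by
  set G := Finset.Icc 1 ((n + 1) * D.p) with hG
  -- The rates still alive at time `t_u`. Regrouping the double product by time instead of by rate
  -- gives one factor per increment, to which independence and the one-step bound apply.
  let act : ℕ → Finset ℕ := fun u => S.filter fun r => u ≤ r * D.p
  have hact : ∀ u, act u ⊆ Finset.Icc 1 n := fun u => (Finset.filter_subset _ _).trans hS
  have hexpand : ∀ ω, ∏ r ∈ S, ENNReal.ofReal (D.rateBound L₀ r (r * D.p) ω) ^ (1 + ε) =
      ((∏ r ∈ S, ENNReal.ofReal (L₀ r ^ (1 + ε))) *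
        ∏ u ∈ G, ENNReal.ofReal (Real.exp (-((1 + ε) * ∑ r ∈ act u, D.logMoment u r)))) *
      ∏ u ∈ G, ENNReal.ofReal
        (Real.exp (((1 + ε) * ∑ r ∈ act u, D.lam u r) * D.increment u ω)) := by
    intro ω
    rw [Finset.prod_congr rfl fun r hr => D.rateBound_rpow (1 + ε) r (r * D.p) ω (hL₀ r (hS hr)),
      Finset.prod_mul_distrib, mul_assoc]
    congr 1
    simp only [← ENNReal.ofReal_prod_of_nonneg fun _ _ => (Real.exp_pos _).le]
    rw [← ENNReal.ofReal_mul (Finset.prod_nonneg fun _ _ => (Real.exp_pos _).le)]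
    congr 1
    simp only [← Real.exp_sum]
    rw [← Real.exp_add, ← Finset.sum_add_distrib, ← Finset.mul_sum,
      Finset.sum_comm' (s' := act) (t' := G)]
    · rw [Finset.mul_sum]
      congr 1
      refine Finset.sum_congr rfl fun u _ => ?_
      rw [Finset.sum_sub_distrib, ← Finset.sum_mul]
      ring
    · intro r u
      simp only [act, hG, Finset.mem_filter, Finset.mem_Icc]
      constructor
      · rintro ⟨hr, h1, h2⟩
        have := (Finset.mem_Icc.1 (hS hr)).2
        exact ⟨⟨hr, h2⟩, h1, h2.trans (Nat.mul_le_mul_right _ (by omega))⟩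
      · rintro ⟨⟨hr, h2⟩, h1, _⟩
        exact ⟨hr, h1, h2⟩
  simp only [hexpand]
  rw [lintegral_const_mul _ (Finset.measurable_fun_prod _ fun u _ =>
    (D.measurable_exp_mul_increment' _ u).ennreal_ofReal), D.lintegral_prod_exp_increment,
    mul_assoc, ← Finset.prod_mul_distrib]
  gcongr
  rw [Finset.mul_sum, Real.exp_sum, ENNReal.ofReal_prod_of_nonneg fun _ _ => (Real.exp_pos _).le]
  refine Finset.prod_le_prod' fun u hu => ?_
  rw [mul_comm]
  exact D.expMoment_mul_exp_logMoment_le hu hn hε (hM u hu) (hT u hu) (hact u)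

/-- A bound, uniform over all models with the same characteristics, for the moment of order `1 + ε`
of the density of a forward measure with respect to the terminal measure. -/
theorem lintegral_density_rpow_le {M ε B : ℝ} (hn : 1 ≤ n) (hε : 0 < ε) (hM₀ : 0 ≤ M)
    (hM : ∀ i ∈ Finset.Icc 1 ((n + 1) * D.p), D.totalLam i ≤ M)
    (hB₀ : 0 ≤ B) (hB : ∑ i ∈ Finset.Icc 1 ((n + 1) * D.p),
      ∫⁻ x, ENNReal.ofReal (truncSqExp ((1 + ε) * M) x) ∂(D.compensator i) ≤ ENNReal.ofReal B)
    {l : ℕ} (hl : 1 ≤ l) :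
    ∫⁻ ω, ((∏ r ∈ Finset.Icc l n, fun ω => ENNReal.ofReal (D.densityFactor L₀ r (r * D.p) ω)) ω)
        ^ (1 + ε) ∂D.P ≤
      momentBound n L₀ M ε B l := by
  have hsub : Finset.Icc l n ⊆ Finset.Icc 1 n := Finset.Icc_subset_Icc_left hl
  have hT : ∀ i ∈ Finset.Icc 1 ((n + 1) * D.p),
      Integrable (truncSqExp ((1 + ε) * M)) (D.compensator i) := by
    intro i hi
    refine ⟨(measurable_truncSqExp _).aestronglyMeasurable, ?_⟩
    rw [hasFiniteIntegral_iff_ofReal (Eventually.of_forall fun x => truncSqExp_nonneg _ x)]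
    exact ((Finset.single_le_sum (f := fun i => ∫⁻ x, ENNReal.ofReal
      (truncSqExp ((1 + ε) * M) x) ∂(D.compensator i)) (fun _ _ => zero_le) hi).trans
        hB).trans_lt ENNReal.ofReal_lt_top
  have hσ : ∑ i ∈ Finset.Icc 1 ((n + 1) * D.p),
      ∫ x, truncSqExp ((1 + ε) * M) x ∂(D.compensator i) ≤ B := by
    rw [← ENNReal.ofReal_le_ofReal_iff hB₀, ENNReal.ofReal_sum_of_nonneg fun i _ =>
      integral_nonneg fun x => truncSqExp_nonneg _ x]
    refine le_trans (le_of_eq (Finset.sum_congr rfl fun i hi => ?_)) hB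
    exact ofReal_integral_eq_lintegral_ofReal (hT i hi)
      (Eventually.of_forall fun x => truncSqExp_nonneg _ x)
  have hbound : ∀ᵐ ω ∂D.P,
      ((∏ r ∈ Finset.Icc l n, fun ω => ENNReal.ofReal (D.densityFactor L₀ r (r * D.p) ω)) ω)
        ^ (1 + ε) ≤ (∏ _r ∈ Finset.Icc l n, (2 : ℝ≥0∞) ^ (1 + ε - 1)) *
          ∑ S ∈ (Finset.Icc l n).powerset,
            ∏ r ∈ S, ENNReal.ofReal (D.rateBound L₀ r (r * D.p) ω) ^ (1 + ε) := by
    filter_upwards [(Filter.eventually_all_finset (Finset.Icc l n)).2 fun r hr =>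
      D.densityFactor_le_rateBound hL₀ (hsub hr)] with ω hω
    -- Convexity gives `(1 + x)^(1+ε) ≤ 2^ε (1 + x^(1+ε))` for each factor; the sum over `S` is the
    -- expansion of the product of the brackets.
    rw [Finset.prod_apply, ← ENNReal.prod_rpow_of_nonneg (by linarith), ← Finset.prod_one_add,
      ← Finset.prod_mul_distrib]
    refine Finset.prod_le_prod' fun r hr => ?_
    refine (ENNReal.rpow_le_rpow (hω r hr) (by linarith)).trans ?_
    simpa using ENNReal.rpow_add_le_mul_rpow_add_rpow 1
      (ENNReal.ofReal (D.rateBound L₀ r (r * D.p) ω)) (show 1 ≤ 1 + ε by linarith)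
  have hmeas : ∀ S : Finset ℕ, Measurable fun ω =>
      ∏ r ∈ S, ENNReal.ofReal (D.rateBound L₀ r (r * D.p) ω) ^ (1 + ε) := fun S =>
    Finset.measurable_fun_prod _ fun r _ =>
      (D.measurable_rateBound r (r * D.p)).ennreal_ofReal.pow_const _
  refine (lintegral_mono_ae hbound).trans ?_
  unfold momentBound
  rw [lintegral_const_mul _ (Finset.measurable_fun_sum _ fun S _ => hmeas S),
    lintegral_finsetSum _ fun S _ => hmeas S]
  gcongr with S hS
  refine (D.lintegral_prod_rateBound_rpow_le hL₀ hn hε hM hT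
    ((Finset.mem_powerset.1 hS).trans hsub)).trans ?_
  have : 0 ≤ 1 / (ε * M) := by positivity
  gcongr

/-- A forward measure is bounded by a power of any other forward measure, with constants depending
only on the characteristics of the model. -/
theorem forwardMeasure_le {M ε B : ℝ} (hn : 1 ≤ n) (hε : 0 < ε) (hM₀ : 0 ≤ M)
    (hM : ∀ i ∈ Finset.Icc 1 ((n + 1) * D.p), D.totalLam i ≤ M)
    (hB₀ : 0 ≤ B) (hB : ∑ i ∈ Finset.Icc 1 ((n + 1) * D.p),
      ∫⁻ x, ENNReal.ofReal (truncSqExp ((1 + ε) * M) x) ∂(D.compensator i) ≤ ENNReal.ofReal B)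
    {j l : ℕ} (hj : 1 ≤ j) (hjn : j ≤ n + 1) (hl : 1 ≤ l) (hln : l ≤ n + 1) {A : Set Ω}
    (hA : MeasurableSet A) :
    D.forwardMeasure L₀ j A ≤ momentBound n L₀ M ε B j ^ (1 / (1 + ε)) *
      ((∏ r ∈ Finset.Icc l n, ENNReal.ofReal (1 + L₀ r)) * D.forwardMeasure L₀ l A) ^
        (1 / (1 + ε).conjExponent) := by
  have hq : 1 < 1 + ε := by linarith
  have hq' := (Real.HolderConjugate.conjExponent hq).symm.pos
  rw [D.forwardMeasure_eq_withDensity_terminal hjn]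
  refine (withDensity_apply_le_of_lintegral_rpow (D.measurable_prod_densityFactor L₀ j) hq hA).trans (mul_le_mul' ?_ ?_)
  · exact ENNReal.rpow_le_rpow (D.lintegral_density_rpow_le hL₀ hn hε hM₀ hM hB₀ hB hj)
      (by positivity)
  · exact ENNReal.rpow_le_rpow (D.measure_le_forwardMeasure hL₀ hl hln A hA) (by positivity)

end LiborData

/-! ### From the power bound to contiguity. -/

theorem contiguous_of_eventually_le_rpow {Ω : ℕ → Type*} [∀ k, MeasurableSpace (Ω k)]
    {Q P : ∀ k, Measure (Ω k)} {C C' : ℝ≥0∞} {s : ℝ} (hC : C ≠ ∞) (hC' : C' ≠ ∞) (hs : 0 < s)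
    (h : ∀ᶠ k in atTop, ∀ A, MeasurableSet A → Q k A ≤ C * (C' * P k A) ^ s) :
    Contiguous Q P := by
  intro A hA hA₀
  have h1 := ENNReal.Tendsto.const_mul hA₀ (Or.inr hC')
  have h2 := (ENNReal.continuous_rpow_const (y := s)).continuousAt.tendsto.comp h1
  have h3 := ENNReal.Tendsto.const_mul h2 (Or.inr hC)
  rw [mul_zero, ENNReal.zero_rpow_of_pos hs, mul_zero] at h3
  exact tendsto_of_tendsto_of_tendsto_of_le_of_le' tendsto_const_nhds h3
    (Eventually.of_forall fun _ => zero_le) (h.mono fun k hk => hk (A k) (hA k))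

end

theorem lemma1 {Ω : ℕ → Type*} [∀ k, MeasurableSpace (Ω k)] (n : ℕ)
    (D : ∀ k, LiborData n (Ω k))
    (L₀ : ℕ → ℝ) (hL₀ : ∀ j ∈ Finset.Icc 1 n, 0 < L₀ j)
    (M ε : ℝ) (hε : 0 < ε)
    (hM : ∀ᶠ k in atTop, ∀ i ∈ Finset.Icc 1 ((n + 1) * (D k).p),
      (∑ j ∈ Finset.Icc 1 n, |(D k).lam i j|) ≤ M)
    (hexp : ∀ u : ℝ, |u| ≤ (1 + ε) * M →
      (⨆ k, ∑ i ∈ Finset.Icc 1 ((n + 1) * (D k).p),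
        (∫⁻ x in {x : ℝ | 1 < |x|}, ENNReal.ofReal (Real.exp (u * x)) ∂((D k).compensator i))) < ∞)
    (hsq : (⨆ k, ∑ i ∈ Finset.Icc 1 ((n + 1) * (D k).p),
        (∫⁻ x : ℝ, ENNReal.ofReal (min (x ^ 2) 1) ∂((D k).compensator i))) < ∞) :
    ∀ j ∈ Finset.Icc 2 (n + 1), ∀ l ∈ Finset.Icc 2 (n + 1),
      Contiguous (fun k => (D k).forwardMeasure L₀ j) (fun k => (D k).forwardMeasure L₀ l) := by
  intro j hj l hl
  obtain ⟨hj2, hjn⟩ := Finset.mem_Icc.1 hj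
  obtain ⟨hl2, hln⟩ := Finset.mem_Icc.1 hl
  rcases Nat.eq_zero_or_pos n with rfl | hn
  · omega
  -- The volatility bound holds for at least one `k`, whose grid is nonempty, so `M` dominates a sum
  -- of absolute values.
  have hM₀ : 0 ≤ M := by
    obtain ⟨k, hk⟩ := hM.exists
    have hmem : 1 ∈ Finset.Icc 1 ((n + 1) * (D k).p) :=
      Finset.mem_Icc.2 ⟨le_rfl, Nat.mul_pos n.succ_pos (D k).p_pos⟩
    exact (Finset.sum_nonneg fun _ _ => abs_nonneg _).trans (hk 1 hmem)
  have hK₀ : 0 ≤ (1 + ε) * M := by positivity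
  -- Only the two extreme orders `u = ±(1 + ε) M` of the tail hypothesis are needed, since together
  -- they control `exp ((1 + ε) M |x|)` on `|x| > 1`.
  set B : ℝ≥0∞ := (⨆ k, ∑ i ∈ Finset.Icc 1 ((n + 1) * (D k).p),
      (∫⁻ x : ℝ, ENNReal.ofReal (min (x ^ 2) 1) ∂((D k).compensator i))) +
    ((⨆ k, ∑ i ∈ Finset.Icc 1 ((n + 1) * (D k).p), (∫⁻ x in {x : ℝ | 1 < |x|},
      ENNReal.ofReal (Real.exp ((1 + ε) * M * x)) ∂((D k).compensator i))) +
    (⨆ k, ∑ i ∈ Finset.Icc 1 ((n + 1) * (D k).p), (∫⁻ x in {x : ℝ | 1 < |x|},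
      ENNReal.ofReal (Real.exp (-((1 + ε) * M) * x)) ∂((D k).compensator i)))) with hB_def
  have hBtop : B ≠ ∞ := (ENNReal.add_lt_top.2 ⟨hsq, ENNReal.add_lt_top.2
    ⟨hexp _ (abs_of_nonneg hK₀).le, hexp _ (by rw [abs_neg, abs_of_nonneg hK₀])⟩⟩).ne
  have hB : ∀ k, ∑ i ∈ Finset.Icc 1 ((n + 1) * (D k).p),
      ∫⁻ x, ENNReal.ofReal (truncSqExp ((1 + ε) * M) x) ∂((D k).compensator i) ≤
        ENNReal.ofReal B.toReal := by
    intro k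
    rw [ENNReal.ofReal_toReal hBtop]
    simp only [lintegral_truncSqExp, Finset.sum_add_distrib]
    exact add_le_add (le_iSup_iff.2 fun _ hb => hb k)
      (add_le_add (le_iSup_iff.2 fun _ hb => hb k) (le_iSup_iff.2 fun _ hb => hb k))
  refine contiguous_of_eventually_le_rpow
    (C := LiborData.momentBound n L₀ M ε B.toReal j ^ (1 / (1 + ε)))
    (C' := ∏ r ∈ Finset.Icc l n, ENNReal.ofReal (1 + L₀ r))
    (ENNReal.rpow_ne_top_of_nonneg (by positivity)
      (LiborData.momentBound_ne_top n L₀ M ε B.toReal j))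
    (ENNReal.prod_ne_top fun _ _ => ENNReal.ofReal_ne_top)
    (one_div_pos.2 (Real.HolderConjugate.conjExponent (show 1 < 1 + ε by linarith)).symm.pos) ?_
  filter_upwards [hM] with k hk A hA
  exact (D k).forwardMeasure_le hL₀ hn hε hM₀ (fun i hi =>
    (Finset.sum_le_sum fun _ _ => le_abs_self _).trans (hk i hi)) ENNReal.toReal_nonneg (hB k)
    (by omega) hjn (by omega) hln hA
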